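/- **Conventions.** Let $\Sigma=\{\land,\lor,\sim,\bot,\top\}$ and $\Sigma^\nabla=\Sigma\cup\{\nabla\}$ with $\nabla$ unary; formulas are built from countably many variables $p,q,r,\dots$ A *logic* is a structural consequence relation $\vdash$ between sets of formulas and formulas (not assumed finitary). A *matrix* is a pair $\langle \mathbf A,D\rangle$ with $D\subseteq A$; $\mathrm{Log}\,\mathcal M$ is the logic with $\Gamma\vdash\varphi$ iff for all $\langle\mathbf A,D\rangle\in\mathcal M$ and all valuations $v$ in $\mathbf A$, $v[\Gamma]\subseteq D$ implies $v(\varphi)\in D$. A matrix is a *model* of a logic $L$ if $L\subseteq\mathrm{Log}\,\langle\mathbf A,D\rangle$; it is *reduced* if the identity is the only congruence $\theta$ of $\mathbf A$ compatible with $D$ (i.e. $a\in D$ and $a\mathrel\theta b$ imply $b\in D$); it is *nontrivial* if $D\neq A$. In a lattice, $\uparrow x=\{y: x\le y\}$. A *De Morgan algebra* is a bounded distributive lattice with an involution $\sim$ satisfying the De Morgan laws and $\sim\top=\bot$, $\sim\bot=\top$; it is a *Kleene algebra* if $x\land\sim x\le y\lor\sim y$. An *involutive Stone (IS-) algebra*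 is a De Morgan algebra with an operation $\nabla$ such that $\nabla\bot=\bot$, $x\le\nabla x$, $\nabla(x\land y)=\nabla x\land\nabla y$ and $\sim\nabla x\land\nabla x=\bot$. The *order-preserving logic* of a class $\mathsf K$ of such algebras: $\emptyset\vdash\varphi$ iff $\mathsf K\models\varphi\approx\top$, and for $\Gamma\ne\emptyset$, $\Gamma\vdash\varphi$ iff there are $\gamma_1,\dots,\gamma_n\in\Gamma$ ($n\ge1$) such that $\gamma_1\land\dots\land\gamma_n\le\varphi$ holds identically in $\mathsf K$. The *1-assertional logic* of $\mathsf K$ is $\mathrm{Log}\{\langle\mathbf A,\{\top\}\rangle:\mathbf A\in\mathsf K\}$. Let $\mathbf{DM}_4$ be the De Morgan algebra on $\{0,a,b,1\}$ with $0<a,b<1$, $a,b$ incomparable, $\sim a=a$, $\sim b=b$, and let $\mathbf K_3$, $\mathbf B_2$ be its subalgebras on $\{0,a,1\}$ and $\{0,1\}$. Let $\mathbf{IS}_6$ be the IS-algebra on $\{\hat 0,0,a,b,1,\hat 1\}$ obtained from $\mathbf{DM}_4$ by adding a new bottom $\hat 0=\bot$ and a new top $\hat 1=\top$, with $\sim\hat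 0=\hat 1$, $\sim\hat 1=\hat 0$, $\nabla\hat 0=\hat 0$ and $\nabla x=\hat 1$ for $x\ne\hat 0$; let $\mathbf{IS}_5$, $\mathbf{IS}_4$ be its subalgebras on $\{\hat 0,0,a,1,\hat 1\}$ and $\{\hat 0,0,1,\hat 1\}$. For a $\Sigma$-algebra $\mathbf A$, let $\mathbf A^\nabla$ be the $\Sigma^\nabla$-algebra obtained in the same way, by adding to $\mathbf A$ a new bottom $\hat 0=\bot$ and a new top $\hat 1=\top$, with $\sim$ and $\nabla$ on them as above and $\nabla x=\hat1$ for $x\in A$; for $\mathbb M=\langle\mathbf A,D\rangle$ put $\mathbb M^\nabla=\langle\mathbf A^\nabla,D\cup\{\hat 1\}\rangle$. For a logic $L$ over $\Sigma$, let $$L^\nabla=\mathrm{Log}\{\mathbb M^\nabla:\ \mathbb M\text{ a nontrivial reduced model of }L\}.$$ Let $\mathcal{IS}_\le$ be the order-preserving logic of the class of IS-algebras, $\mathcal{ETL}$ the 1-assertional logic of De Morgan algebras, $\mathcal{LP}=\mathrm{Log}\langle\mathbf K_3,\uparrow a\rangle$, $\mathcal K_1$ and $\mathcal K_\le$ the 1-assertional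 and the order-preserving logic of Kleene algebras, and $\mathcal{CL}=\mathrm{Log}\langle\mathbf B_2,\{1\}\rangle$. For a set $R$ of rules, $\mathcal{IS}_\le+R$ is the least logic over $\Sigma^\nabla$ that contains $\mathcal{IS}_\le$ and $R$. Consider the rules - (DS) $p\land(\sim p\lor q)\vdash q$; - ($K_1$) $(p\land\sim p)\lor q\vdash q$; - ($K_\le$) $(p\land\sim p)\lor r\vdash q\lor\sim q\lor r$; - (EM) $\emptyset\vdash p\lor\sim p$. **Theorem.** 1. $\mathrm{Log}\langle\mathbf{IS}_6,\uparrow1\rangle=\mathcal{ETL}^\nabla=\mathcal{IS}_\le+(\mathrm{DS})$. 2. $\mathrm{Log}\langle\mathbf{IS}_5,\uparrow a\rangle=\mathcal{LP}^\nabla=\mathcal{IS}_\le+(\mathrm{EM})$. 3. $\mathrm{Log}\langle\mathbf{IS}_5,\uparrow1\rangle=\mathcal K_1^\nabla=\mathcal{IS}_\le+(K_1)$. 4. $\mathrm{Log}\{\langle\mathbf{IS}_5,\uparrow a\rangle,\langle\mathbf{IS}_5,\uparrow1\rangle\}=\mathcal K_\le^\nabla=\mathcal{IS}_\le+(K_\le)$.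 5. $\mathrm{Log}\langle\mathbf{IS}_4,\uparrow1\rangle=\mathcal{CL}^\nabla=\mathcal{IS}_\le+(\mathrm{DS})+(\mathrm{EM})$. -/

import Mathlib

universe u

namespace ISLogic

/-! ### Formulas and logics

Propositional variables are indexed by `ℕ`. -/

/-- Formulas in the language of De Morgan algebras. -/
inductive DMFm : Type
  | var (n : ℕ)
  | meet (φ ψ : DMFm)
  | join (φ ψ : DMFm)
  | neg (φ : DMFm)
  | bot
  | top

/-- Formulas in the language of involutive Stone algebras (the language of De Morgan algebras
expanded with the unary connective `nab`). -/
inductive ISFm : Type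
  | var (n : ℕ)
  | meet (φ ψ : ISFm)
  | join (φ ψ : ISFm)
  | neg (φ : ISFm)
  | nab (φ : ISFm)
  | bot
  | top

/-- Uniform substitution of formulas for variables. -/
def ISFm.subst (σ : ℕ → ISFm) : ISFm → ISFm
  | .var n => σ n
  | .meet φ ψ => .meet (φ.subst σ) (ψ.subst σ)
  | .join φ ψ => .join (φ.subst σ) (ψ.subst σ)
  | .neg φ => .neg (φ.subst σ)
  | .nab φ => .nab (φ.subst σ)
  | .bot => .bot
  | .top => .top

/-- Relations between sets of formulas and formulas in the De Morgan language. -/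
abbrev DMRel := Set DMFm → DMFm → Prop

/-- Relations between sets of formulas and formulas in the language with `nab`. -/
abbrev ISRel := Set ISFm → ISFm → Prop

/-- A (single-conclusion) logic: a structural consequence relation, not assumed finitary. -/
structure IsLogic (L : ISRel) : Prop where
  refl : ∀ Γ φ, φ ∈ Γ → L Γ φ
  mono : ∀ Γ Δ φ, Γ ⊆ Δ → L Γ φ → L Δ φ
  cut : ∀ Γ Δ φ, (∀ δ ∈ Δ, L Γ δ) → L Δ φ → L Γ φ
  structural : ∀ (σ : ℕ → ISFm) Γ φ, L Γ φ → L (ISFm.subst σ '' Γ) (φ.subst σ)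

/-- `extend L R` is `L + R`, the least logic that contains `L` and the rules in `R`. -/
def extend (L : ISRel) (R : Set (Set ISFm × ISFm)) : ISRel := fun Γ φ =>
  ∀ L' : ISRel, IsLogic L' → (∀ Δ ψ, L Δ ψ → L' Δ ψ) → (∀ r ∈ R, L' r.1 r.2) → L' Γ φ

/-! ### Algebras and matrices -/

/-- Algebras in the language of De Morgan algebras. -/
structure DMAlg : Type (u + 1) where
  carrier : Type u
  meet : carrier → carrier → carrier
  join : carrier → carrier → carrier
  neg : carrier → carrier
  bot : carrier
  top : carrier

/-- Algebras in the language of involutive Stone algebras. -/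
structure ISAlg : Type (u + 1) extends DMAlg.{u} where
  nab : carrier → carrier

/-- The homomorphism from the formula algebra that extends an assignment `v`. -/
def DMAlg.eval (A : DMAlg.{u}) (v : ℕ → A.carrier) : DMFm → A.carrier
  | .var n => v n
  | .meet φ ψ => A.meet (A.eval v φ) (A.eval v ψ)
  | .join φ ψ => A.join (A.eval v φ) (A.eval v ψ)
  | .neg φ => A.neg (A.eval v φ)
  | .bot => A.bot
  | .top => A.top

/-- The homomorphism from the formula algebra that extends an assignment `v`. -/
def ISAlg.eval (A : ISAlg.{u}) (v : ℕ → A.carrier) : ISFm → A.carrier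
  | .var n => v n
  | .meet φ ψ => A.meet (A.eval v φ) (A.eval v ψ)
  | .join φ ψ => A.join (A.eval v φ) (A.eval v ψ)
  | .neg φ => A.neg (A.eval v φ)
  | .nab φ => A.nab (A.eval v φ)
  | .bot => A.bot
  | .top => A.top

/-- The principal up-set `↑x`, for the order `x ≤ y ↔ x ∧ y = x`. -/
def DMAlg.up (A : DMAlg.{u}) (x : A.carrier) : Set A.carrier := {y | A.meet x y = x}

/-- Matrices (algebras with a set of designated elements) in the De Morgan language. -/
structure DMMatrix : Type (u + 1) where
  alg : DMAlg.{u}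
  D : Set alg.carrier

/-- Matrices in the language with `nab`. -/
structure ISMatrix : Type (u + 1) where
  alg : ISAlg.{u}
  D : Set alg.carrier

/-- The logic determined by a class of matrices. -/
def DMLog (𝓜 : Set DMMatrix.{u}) : DMRel := fun Γ φ =>
  ∀ M ∈ 𝓜, ∀ v : ℕ → M.alg.carrier, (∀ γ ∈ Γ, M.alg.eval v γ ∈ M.D) → M.alg.eval v φ ∈ M.D

/-- The logic determined by a class of matrices. -/
def ISLog (𝓜 : Set ISMatrix.{u}) : ISRel := fun Γ φ =>
  ∀ M ∈ 𝓜, ∀ v : ℕ → M.alg.carrier, (∀ γ ∈ Γ, M.alg.eval v γ ∈ M.D) → M.alg.eval v φ ∈ M.D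

/-- Validity of the identity `φ ≈ ψ` in a class of algebras. -/
def DMValid (K : Set DMAlg.{u}) (φ ψ : DMFm) : Prop :=
  ∀ A ∈ K, ∀ v : ℕ → A.carrier, A.eval v φ = A.eval v ψ

/-- Validity of the identity `φ ≈ ψ` in a class of algebras. -/
def ISValid (K : Set ISAlg.{u}) (φ ψ : ISFm) : Prop :=
  ∀ A ∈ K, ∀ v : ℕ → A.carrier, A.eval v φ = A.eval v ψ

/-- The order-preserving logic of a class of algebras: a formula follows from the empty set when
it is identically `⊤`, and from a nonempty `Γ` when it is identically above some finite meet
`γ ∧ γ₁ ∧ … ∧ γₙ` of members of `Γ`. -/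
def DMOrderLogic (K : Set DMAlg.{u}) : DMRel := fun Γ φ =>
  (Γ = ∅ ∧ DMValid K φ .top) ∨
  ∃ (γ : DMFm) (l : List DMFm), γ ∈ Γ ∧ (∀ ψ ∈ l, ψ ∈ Γ) ∧
    DMValid K (.meet (l.foldl .meet γ) φ) (l.foldl .meet γ)

/-- The order-preserving logic of a class of algebras in the language with `nab`. -/
def ISOrderLogic (K : Set ISAlg.{u}) : ISRel := fun Γ φ =>
  (Γ = ∅ ∧ ISValid K φ .top) ∨
  ∃ (γ : ISFm) (l : List ISFm), γ ∈ Γ ∧ (∀ ψ ∈ l, ψ ∈ Γ) ∧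
    ISValid K (.meet (l.foldl .meet γ) φ) (l.foldl .meet γ)

/-- The 1-assertional logic of a class of algebras. -/
def DMAssertional (K : Set DMAlg.{u}) : DMRel := DMLog {M | M.alg ∈ K ∧ M.D = {M.alg.top}}

/-! ### Varieties -/

/-- De Morgan algebras. -/
structure IsDeMorgan (A : DMAlg.{u}) : Prop where
  meet_comm : ∀ x y, A.meet x y = A.meet y x
  join_comm : ∀ x y, A.join x y = A.join y x
  meet_assoc : ∀ x y z, A.meet (A.meet x y) z = A.meet x (A.meet y z)
  join_assoc : ∀ x y z, A.join (A.join x y) z = A.join x (A.join y z)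
  meet_join_self : ∀ x y, A.meet x (A.join x y) = x
  join_meet_self : ∀ x y, A.join x (A.meet x y) = x
  meet_join_distrib : ∀ x y z, A.meet x (A.join y z) = A.join (A.meet x y) (A.meet x z)
  bot_meet : ∀ x, A.meet A.bot x = A.bot
  meet_top : ∀ x, A.meet x A.top = x
  neg_join : ∀ x y, A.neg (A.join x y) = A.meet (A.neg x) (A.neg y)
  neg_meet : ∀ x y, A.neg (A.meet x y) = A.join (A.neg x) (A.neg y)
  neg_neg : ∀ x, A.neg (A.neg x) = x
  neg_top : A.neg A.top = A.bot
  neg_bot : A.neg A.bot = A.top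

/-- Kleene algebras: De Morgan algebras that satisfy `x ∧ ∼x ≤ y ∨ ∼y`. -/
structure IsKleene (A : DMAlg.{u}) : Prop extends IsDeMorgan A where
  kleene : ∀ x y,
    A.meet (A.meet x (A.neg x)) (A.join y (A.neg y)) = A.meet x (A.neg x)

/-- Involutive Stone algebras. -/
structure IsInvolutiveStone (A : ISAlg.{u}) : Prop extends IsDeMorgan A.toDMAlg where
  nab_bot : A.nab A.bot = A.bot
  le_nab : ∀ x, A.meet x (A.nab x) = x
  nab_meet : ∀ x y, A.nab (A.meet x y) = A.meet (A.nab x) (A.nab y)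
  neg_nab_meet_nab : ∀ x, A.meet (A.neg (A.nab x)) (A.nab x) = A.bot

/-! ### The finite algebras and matrices -/

/-- The four elements of `DM₄`. -/
inductive DM4Carrier : Type
  | zero | a | b | one

open DM4Carrier in
/-- The four-element De Morgan algebra `0 < a, b < 1` with `∼a = a` and `∼b = b`. -/
def DM4 : DMAlg.{0} where
  carrier := DM4Carrier
  meet
    | zero, _ => zero
    | _, zero => zero
    | one, y => y
    | x, one => x
    | a, a => a
    | b, b => b
    | a, b => zero
    | b, a => zero
  join
    | one, _ => one
    | _, one => one
    | zero, y => y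
    | x, zero => x
    | a, a => a
    | b, b => b
    | a, b => one
    | b, a => one
  neg
    | zero => one
    | a => a
    | b => b
    | one => zero
  bot := zero
  top := one

/-- The six elements of `IS₆`. -/
inductive IS6Carrier : Type
  | bbot | zero | a | b | one | ttop

open IS6Carrier in
/-- The six-element involutive Stone algebra, with order `bbot < 0 < a, b < 1 < ttop`. -/
def IS6 : ISAlg.{0} where
  carrier := IS6Carrier
  meet
    | bbot, _ => bbot
    | _, bbot => bbot
    | ttop, y => y
    | x, ttop => x
    | zero, _ => zero
    | _, zero => zero
    | one, y => y
    | x, one => x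
    | a, a => a
    | b, b => b
    | a, b => zero
    | b, a => zero
  join
    | ttop, _ => ttop
    | _, ttop => ttop
    | bbot, y => y
    | x, bbot => x
    | one, _ => one
    | _, one => one
    | zero, y => y
    | x, zero => x
    | a, a => a
    | b, b => b
    | a, b => one
    | b, a => one
  neg
    | bbot => ttop
    | zero => one
    | a => a
    | b => b
    | one => zero
    | ttop => bbot
  bot := bbot
  top := ttop
  nab
    | bbot => bbot
    | _ => ttop

/-- Closure of a subset under the operations of an algebra in the De Morgan language. -/
structure DMAlg.IsClosed (A : DMAlg.{u}) (S : Set A.carrier) : Prop where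
  meet : ∀ x ∈ S, ∀ y ∈ S, A.meet x y ∈ S
  join : ∀ x ∈ S, ∀ y ∈ S, A.join x y ∈ S
  neg : ∀ x ∈ S, A.neg x ∈ S
  bot : A.bot ∈ S
  top : A.top ∈ S

/-- The subalgebra with universe `S`. -/
def DMAlg.sub (A : DMAlg.{u}) (S : Set A.carrier) (h : A.IsClosed S) : DMAlg.{u} where
  carrier := S
  meet x y := ⟨A.meet x y, h.meet _ x.2 _ y.2⟩
  join x y := ⟨A.join x y, h.join _ x.2 _ y.2⟩
  neg x := ⟨A.neg x, h.neg _ x.2⟩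
  bot := ⟨A.bot, h.bot⟩
  top := ⟨A.top, h.top⟩

/-- The subalgebra with universe `S`. -/
def ISAlg.sub (A : ISAlg.{u}) (S : Set A.carrier) (h : A.toDMAlg.IsClosed S)
    (hn : ∀ x ∈ S, A.nab x ∈ S) : ISAlg.{u} where
  toDMAlg := A.toDMAlg.sub S h
  nab x := ⟨A.nab x.1, hn _ x.2⟩

/-- The universe of `K₃`. -/
def K3Set : Set DM4Carrier := {.zero, .a, .one}

/-- The universe of `B₂`. -/
def B2Set : Set DM4Carrier := {.zero, .one}

/-- The universe of `IS₅`. -/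
def IS5Set : Set IS6Carrier := {.bbot, .zero, .a, .one, .ttop}

/-- The universe of `IS₄`. -/
def IS4Set : Set IS6Carrier := {.bbot, .zero, .one, .ttop}

theorem K3Set_closed : DM4.IsClosed K3Set := by
  constructor
  case meet => rintro _ (rfl|rfl|rfl) _ (rfl|rfl|rfl) <;>
    first | exact Or.inl rfl | exact Or.inr (Or.inl rfl) | exact Or.inr (Or.inr rfl)
  case join => rintro _ (rfl|rfl|rfl) _ (rfl|rfl|rfl) <;>
    first | exact Or.inl rfl | exact Or.inr (Or.inl rfl) | exact Or.inr (Or.inr rfl)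
  case neg => rintro _ (rfl|rfl|rfl) <;>
    first | exact Or.inl rfl | exact Or.inr (Or.inl rfl) | exact Or.inr (Or.inr rfl)
  case bot => exact Or.inl rfl
  case top => exact Or.inr (Or.inr rfl)

theorem B2Set_closed : DM4.IsClosed B2Set := by
  constructor
  case meet => rintro _ (rfl|rfl) _ (rfl|rfl) <;>
    first | exact Or.inl rfl | exact Or.inr rfl
  case join => rintro _ (rfl|rfl) _ (rfl|rfl) <;>
    first | exact Or.inl rfl | exact Or.inr rfl
  case neg => rintro _ (rfl|rfl) <;>
    first | exact Or.inl rfl | exact Or.inr rfl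
  case bot => exact Or.inl rfl
  case top => exact Or.inr rfl

theorem IS5Set_closed : IS6.toDMAlg.IsClosed IS5Set := by
  constructor
  case meet => rintro _ (rfl|rfl|rfl|rfl|rfl) _ (rfl|rfl|rfl|rfl|rfl) <;>
    first | exact Or.inl rfl | exact Or.inr (Or.inl rfl) | exact Or.inr (Or.inr (Or.inl rfl)) | exact Or.inr (Or.inr (Or.inr (Or.inl rfl))) | exact Or.inr (Or.inr (Or.inr (Or.inr rfl)))
  case join => rintro _ (rfl|rfl|rfl|rfl|rfl) _ (rfl|rfl|rfl|rfl|rfl) <;>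
    first | exact Or.inl rfl | exact Or.inr (Or.inl rfl) | exact Or.inr (Or.inr (Or.inl rfl)) | exact Or.inr (Or.inr (Or.inr (Or.inl rfl))) | exact Or.inr (Or.inr (Or.inr (Or.inr rfl)))
  case neg => rintro _ (rfl|rfl|rfl|rfl|rfl) <;>
    first | exact Or.inl rfl | exact Or.inr (Or.inl rfl) | exact Or.inr (Or.inr (Or.inl rfl)) | exact Or.inr (Or.inr (Or.inr (Or.inl rfl))) | exact Or.inr (Or.inr (Or.inr (Or.inr rfl)))
  case bot => exact Or.inl rfl
  case top => exact Or.inr (Or.inr (Or.inr (Or.inr rfl)))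

theorem IS4Set_closed : IS6.toDMAlg.IsClosed IS4Set := by
  constructor
  case meet => rintro _ (rfl|rfl|rfl|rfl) _ (rfl|rfl|rfl|rfl) <;>
    first | exact Or.inl rfl | exact Or.inr (Or.inl rfl) | exact Or.inr (Or.inr (Or.inl rfl)) | exact Or.inr (Or.inr (Or.inr rfl))
  case join => rintro _ (rfl|rfl|rfl|rfl) _ (rfl|rfl|rfl|rfl) <;>
    first | exact Or.inl rfl | exact Or.inr (Or.inl rfl) | exact Or.inr (Or.inr (Or.inl rfl)) | exact Or.inr (Or.inr (Or.inr rfl))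
  case neg => rintro _ (rfl|rfl|rfl|rfl) <;>
    first | exact Or.inl rfl | exact Or.inr (Or.inl rfl) | exact Or.inr (Or.inr (Or.inl rfl)) | exact Or.inr (Or.inr (Or.inr rfl))
  case bot => exact Or.inl rfl
  case top => exact Or.inr (Or.inr (Or.inr rfl))

theorem IS5Set_nab : ∀ x ∈ IS5Set, IS6.nab x ∈ IS5Set := by
  rintro _ (rfl|rfl|rfl|rfl|rfl) <;>
    first | exact Or.inl rfl | exact Or.inr (Or.inl rfl) | exact Or.inr (Or.inr (Or.inl rfl)) | exact Or.inr (Or.inr (Or.inr (Or.inl rfl))) | exact Or.inr (Or.inr (Or.inr (Or.inr rfl)))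

theorem IS4Set_nab : ∀ x ∈ IS4Set, IS6.nab x ∈ IS4Set := by
  rintro _ (rfl|rfl|rfl|rfl) <;>
    first | exact Or.inl rfl | exact Or.inr (Or.inl rfl) | exact Or.inr (Or.inr (Or.inl rfl)) | exact Or.inr (Or.inr (Or.inr rfl))

/-- The three-element Kleene algebra `0 < a < 1`. -/
def K3 : DMAlg.{0} := DM4.sub K3Set K3Set_closed

/-- The two-element Boolean algebra. -/
def B2 : DMAlg.{0} := DM4.sub B2Set B2Set_closed

/-- The five-element chain `bbot < 0 < a < 1 < ttop`. -/
def IS5 : ISAlg.{0} := IS6.sub IS5Set IS5Set_closed IS5Set_nab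

/-- The four-element chain `bbot < 0 < 1 < ttop`. -/
def IS4 : ISAlg.{0} := IS6.sub IS4Set IS4Set_closed IS4Set_nab

/-- The element `a` of `K₃`. -/
def K3.a : K3.carrier := (⟨.a, by simp [K3Set]⟩ : K3Set)

/-- The element `a` of `IS₅`. -/
def IS5.a : IS5.carrier := (⟨.a, by simp [IS5Set]⟩ : IS5Set)

/-- The element `1` of `IS₅` (the coatom). -/
def IS5.one : IS5.carrier := (⟨.one, by simp [IS5Set]⟩ : IS5Set)

/-- The element `1` of `IS₄` (the coatom). -/
def IS4.one : IS4.carrier := (⟨.one, by simp [IS4Set]⟩ : IS4Set)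

/-- The matrix `⟨IS₆, ↑1⟩`. -/
def matIS6one : ISMatrix.{0} := ⟨IS6, IS6.up IS6Carrier.one⟩

/-- The matrix `⟨IS₅, ↑a⟩`. -/
def matIS5a : ISMatrix.{0} := ⟨IS5, IS5.up IS5.a⟩

/-- The matrix `⟨IS₅, ↑1⟩`. -/
def matIS5one : ISMatrix.{0} := ⟨IS5, IS5.up IS5.one⟩

/-- The matrix `⟨IS₄, ↑1⟩`. -/
def matIS4one : ISMatrix.{0} := ⟨IS4, IS4.up IS4.one⟩

/-! ### Adding the connective `nab` to a logic -/

/-- A set with two new elements. -/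
inductive Adjoin (A : Type u) : Type u
  | bbot
  | of (x : A)
  | ttop

open Adjoin in
/-- The algebra obtained by adding a new bottom and a new top, which interpret the constants, and
the operation `nab`. -/
def DMAlg.nabla (A : DMAlg.{u}) : ISAlg.{u} where
  carrier := Adjoin A.carrier
  meet
    | bbot, _ => bbot
    | _, bbot => bbot
    | ttop, y => y
    | x, ttop => x
    | of x, of y => of (A.meet x y)
  join
    | ttop, _ => ttop
    | _, ttop => ttop
    | bbot, y => y
    | x, bbot => x
    | of x, of y => of (A.join x y)
  neg
    | bbot => ttop
    | of x => of (A.neg x)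
    | ttop => bbot
  bot := bbot
  top := ttop
  nab
    | bbot => bbot
    | _ => ttop

/-- The matrix `⟨A^∇, D ∪ {ttop}⟩` obtained from `⟨A, D⟩`. -/
def DMMatrix.nabla (M : DMMatrix.{u}) : ISMatrix.{u} :=
  ⟨M.alg.nabla, (Adjoin.of '' M.D ∪ {Adjoin.ttop} : Set (Adjoin M.alg.carrier))⟩

/-- `M` is a model of the logic `L`. -/
def DMMatrix.IsModel (M : DMMatrix.{u}) (L : DMRel) : Prop :=
  ∀ Γ φ, L Γ φ → DMLog {M} Γ φ

/-- Congruences of an algebra in the De Morgan language. -/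
structure DMAlg.IsCongruence (A : DMAlg.{u}) (θ : Setoid A.carrier) : Prop where
  meet : ∀ x x' y y', θ x x' → θ y y' → θ (A.meet x y) (A.meet x' y')
  join : ∀ x x' y y', θ x x' → θ y y' → θ (A.join x y) (A.join x' y')
  neg : ∀ x x', θ x x' → θ (A.neg x) (A.neg x')

/-- `M` is reduced: its Leibniz congruence (the greatest congruence compatible with `D`) is the
identity, that is, every congruence compatible with `D` is contained in the identity. -/
def DMMatrix.IsReduced (M : DMMatrix.{u}) : Prop :=
  ∀ θ : Setoid M.alg.carrier, M.alg.IsCongruence θ →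
    (∀ x y, θ x y → x ∈ M.D → y ∈ M.D) → ∀ x y, θ x y → x = y

/-- The logic `L^∇`, determined by the matrices `M^∇` for the reduced models `M` of `L` that are
nontrivial, in the sense that some element is not designated. -/
def nablaLogic (L : DMRel) : ISRel :=
  ISLog {N : ISMatrix.{u} | ∃ M : DMMatrix.{u},
    M.IsModel L ∧ M.IsReduced ∧ M.D ≠ Set.univ ∧ N = M.nabla}

/-! ### The logics and rules at issue -/

/-- The order-preserving logic of involutive Stone algebras. -/
def ISle : ISRel := ISOrderLogic {A : ISAlg.{u} | IsInvolutiveStone A}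

/-- Exactly True Logic: the 1-assertional logic of De Morgan algebras. -/
def ETL : DMRel := DMAssertional {A : DMAlg.{u} | IsDeMorgan A}

/-- The Logic of Paradox. -/
def LP : DMRel := DMLog {⟨K3, K3.up K3.a⟩}

/-- The 1-assertional logic of Kleene algebras. -/
def Kone : DMRel := DMAssertional {A : DMAlg.{u} | IsKleene A}

/-- The order-preserving logic of Kleene algebras. -/
def Kle : DMRel := DMOrderLogic {A : DMAlg.{u} | IsKleene A}

/-- Classical logic. -/
def CL : DMRel := DMLog {⟨B2, {B2.top}⟩}

/-- The variable `p`. -/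
abbrev p : ISFm := .var 0
/-- The variable `q`. -/
abbrev q : ISFm := .var 1
/-- The variable `r`. -/
abbrev r : ISFm := .var 2

/-- `p ∧ (∼p ∨ q) ⊢ q`. -/
def ruleDS : Set ISFm × ISFm := ({.meet p (.join (.neg p) q)}, q)

/-- `(p ∧ ∼p) ∨ q ⊢ q`. -/
def ruleK1 : Set ISFm × ISFm := ({.join (.meet p (.neg p)) q}, q)

/-- `(p ∧ ∼p) ∨ r ⊢ q ∨ ∼q ∨ r`. -/
def ruleKle : Set ISFm × ISFm := ({.join (.meet p (.neg p)) r}, .join (.join q (.neg q)) r)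

/-- `∅ ⊢ p ∨ ∼p`. -/
def ruleEM : Set ISFm × ISFm := (∅, .join p (.neg p))

end ISLogic

/-!
In each of the five items the three logics are compared in a cycle: the logic `L^∇` is contained in
the logic of the finite matrices, which is contained in the extension of `IS_≤` by the rules, which
is contained in `L^∇`.

*From `L^∇` to the finite matrices.* The matrices `⟨DM₄, {1}⟩`, `⟨K₃, ↑a⟩`, `⟨K₃, {1}⟩` and
`⟨B₂, {1}⟩` are nontrivial reduced models of the logics at issue, and adding a new bottom and top to
them gives the finite matrices over `IS₆`, `IS₅` and `IS₄`. Since `nablaLogic.{u}` ranges over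
matrices in the universe `u`, copies of the finite matrices in that universe are used.

*From the finite matrices to the extension of `IS_≤`.* A prime filter `P` of an involutive Stone
algebra is the preimage of `↑a` under a homomorphism to `IS₆`: the image of `x` is determined by
which of `x`, `∼x`, `∇x`, `∇∼x` belong to `P` (`DMAlg.IsPrimeFilter.exists_isHom`). With the prime
filter theorem it follows that a theory `T` of `IS_≤` and a directed set of formulas disjoint from
`T` are separated by a valuation in `⟨IS₆, ↑a⟩` (`IsTheory.exists_valuation`). If `φ ∉ T`, then `φ`
can be joined by further formulas to be kept outside the filter, and the rules are what makes the
resulting ideal disjoint from `T`: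

* with `(DS)`, the negations of the members of `T`, so that `T` is sent to `↑1`;
* with `(K₁)`, all contradictions `x ∧ ∼x`, so that the value `a` is avoided, and the automorphism
  of `IS₆` exchanging `a` and `b` leads to `⟨IS₅, ↑1⟩`;
* with `(EM)` nothing more is needed, as excluded middle already excludes the value `b`;
* with `(K_≤)`, either all contradictions can be kept outside the filter, or all instances of
  excluded middle can be added to it.

*From the extension of `IS_≤` to `L^∇`.* The algebra `A` of a reduced model `⟨A, D⟩` is a De Morgan
algebra, because the two sides of an identity of De Morgan algebras are related by the Leibniz
congruence (`DMMatrix.IsReduced.isDeMorgan`). So `A^∇` is an involutive Stone algebra in which the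
designated elements form a filter, and the rules hold for the new elements by inspection. That the
model is nontrivial is used for `(DS)` and `(K₁)`: no contradiction is designated in it.
-/

universe v w

namespace ISLogic

/-! ### Homomorphisms -/

/-- Homomorphisms between algebras in the language with `nab`. -/
structure ISAlg.IsHom {A : ISAlg.{u}} {B : ISAlg.{v}} (f : A.carrier → B.carrier) : Prop where
  meet : ∀ x y, f (A.meet x y) = B.meet (f x) (f y)
  join : ∀ x y, f (A.join x y) = B.join (f x) (f y)
  neg : ∀ x, f (A.neg x) = B.neg (f x)
  nab : ∀ x, f (A.nab x) = B.nab (f x)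
  bot : f A.bot = B.bot
  top : f A.top = B.top

theorem ISAlg.IsHom.eval {A : ISAlg.{u}} {B : ISAlg.{v}} {f : A.carrier → B.carrier}
    (hf : ISAlg.IsHom f) (v : ℕ → A.carrier) (φ : ISFm) :
    f (A.eval v φ) = B.eval (f ∘ v) φ := by
  induction φ with
  | var n => rfl
  | meet φ ψ h₁ h₂ => simp only [ISAlg.eval, hf.meet, h₁, h₂]
  | join φ ψ h₁ h₂ => simp only [ISAlg.eval, hf.join, h₁, h₂]
  | neg φ h => simp only [ISAlg.eval, hf.neg, h]
  | nab φ h => simp only [ISAlg.eval, hf.nab, h]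
  | bot => exact hf.bot
  | top => exact hf.top

/-- A strict homomorphism into a matrix transfers every inference valid in that matrix. -/
theorem ISLog_of_strict_hom {M : ISMatrix.{u}} {N : ISMatrix.{v}}
    {f : M.alg.carrier → N.alg.carrier} (hf : ISAlg.IsHom f) (hD : ∀ x, f x ∈ N.D ↔ x ∈ M.D)
    {Γ : Set ISFm} {φ : ISFm} (h : ISLog {N} Γ φ) : ISLog {M} Γ φ := by
  rintro _ rfl v hv
  rw [← hD, hf.eval]
  refine h N rfl (f ∘ v) fun γ hγ => ?_
  rw [← hf.eval, hD]
  exact hv γ hγ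

theorem ISAlg.eval_subst (A : ISAlg.{u}) (v : ℕ → A.carrier) (σ : ℕ → ISFm) (φ : ISFm) :
    A.eval v (φ.subst σ) = A.eval (fun n => A.eval v (σ n)) φ := by
  induction φ with
  | var n => rfl
  | meet φ ψ h₁ h₂ => simp only [ISAlg.eval, ISFm.subst, h₁, h₂]
  | join φ ψ h₁ h₂ => simp only [ISAlg.eval, ISFm.subst, h₁, h₂]
  | neg φ h => simp only [ISAlg.eval, ISFm.subst, h]
  | nab φ h => simp only [ISAlg.eval, ISFm.subst, h]
  | bot => rfl
  | top => rfl

theorem ISLog_isLogic (𝓜 : Set ISMatrix.{u}) : IsLogic (ISLog 𝓜) where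
  refl Γ φ h M _ v hv := hv φ h
  mono Γ Δ φ hs h M hM v hv := h M hM v fun γ hγ => hv γ (hs hγ)
  cut Γ Δ φ h₁ h₂ M hM v hv := h₂ M hM v fun δ hδ => h₁ δ hδ M hM v hv
  structural σ Γ φ h M hM v hv := by
    rw [ISAlg.eval_subst]
    refine h M hM _ fun γ hγ => ?_
    rw [← ISAlg.eval_subst]
    exact hv _ ⟨γ, hγ, rfl⟩

/-! ### The lattice order -/

/-- The distributive lattice underlying a De Morgan algebra. -/
abbrev IsDeMorgan.distribLattice {A : DMAlg.{u}} (h : IsDeMorgan A) :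
    DistribLattice A.carrier :=
  letI : Max A.carrier := ⟨A.join⟩
  letI : Min A.carrier := ⟨A.meet⟩
  letI : Lattice A.carrier := Lattice.mk' h.join_comm h.join_assoc h.meet_comm h.meet_assoc
    h.join_meet_self h.meet_join_self
  DistribLattice.ofInfSupLe fun a b c => (h.meet_join_distrib a b c).le

theorem IsDeMorgan.le_iff {A : DMAlg.{u}} (h : IsDeMorgan A) (x y : A.carrier) :
    h.distribLattice.le x y ↔ A.meet x y = x :=
  letI := h.distribLattice
  (inf_eq_left (a := x) (b := y)).symm

/-! ### Prime filters -/

/-- Prime filters, given by their membership conditions. -/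
structure DMAlg.IsPrimeFilter (A : DMAlg.{u}) (P : Set A.carrier) : Prop where
  meet : ∀ x y, A.meet x y ∈ P ↔ x ∈ P ∧ y ∈ P
  join : ∀ x y, A.join x y ∈ P ↔ x ∈ P ∨ y ∈ P
  top : A.top ∈ P
  bot : A.bot ∉ P

/-- The prime filter theorem: a filter `F` and an ideal `I` that are disjoint are separated by a
prime filter. -/
theorem IsDeMorgan.exists_isPrimeFilter {A : DMAlg.{u}} (h : IsDeMorgan A) {F I : Set A.carrier}
    (hFtop : A.top ∈ F) (hFmeet : ∀ x ∈ F, ∀ y ∈ F, A.meet x y ∈ F)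
    (hFup : ∀ x y, A.meet x y = x → x ∈ F → y ∈ F)
    (hIbot : A.bot ∈ I) (hIjoin : ∀ x ∈ I, ∀ y ∈ I, A.join x y ∈ I)
    (hIdown : ∀ x y, A.meet x y = x → y ∈ I → x ∈ I) (hd : Disjoint F I) :
    ∃ P, A.IsPrimeFilter P ∧ F ⊆ P ∧ Disjoint P I := by
  let := h.distribLattice
  let F' : Order.PFilter A.carrier := ⟨
    { carrier := F
      lower' := fun x y hxy hx => hFup x y ((h.le_iff x y).1 hxy) hx
      nonempty' := ⟨A.top, hFtop⟩
      directed' := fun x hx y hy => ⟨A.meet x y, hFmeet x hx y hy,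
        (inf_le_left : (min x y : A.carrier) ≤ x), (inf_le_right : (min x y : A.carrier) ≤ y)⟩ }⟩
  let I' : Order.Ideal A.carrier :=
    { carrier := I
      lower' := fun y x hxy hy => hIdown x y ((h.le_iff x y).1 hxy) hy
      nonempty' := ⟨A.bot, hIbot⟩
      directed' := fun x hx y hy => ⟨A.join x y, hIjoin x hx y hy,
        le_sup_left (a := x) (b := y), le_sup_right (a := x) (b := y)⟩ }
  obtain ⟨J, hJ, hIJ, hFJ⟩ :=
    DistribLattice.prime_ideal_of_disjoint_filter_ideal (F := F') (I := I') hd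
  refine ⟨(J : Set A.carrier)ᶜ, ⟨fun x y => ?_, fun x y => ?_, ?_, ?_⟩, ?_, ?_⟩
  · have : A.meet x y ∈ J ↔ x ∈ J ∨ y ∈ J :=
      ⟨fun hh => hJ.mem_or_mem hh, fun hh => hh.elim (fun hx => J.lower (inf_le_left (b := y)) hx)
        (fun hy => J.lower (inf_le_right (a := x)) hy)⟩
    simp [this]
  · have : A.join x y ∈ J ↔ x ∈ J ∧ y ∈ J := Order.Ideal.sup_mem_iff
    simp only [Set.mem_compl_iff, SetLike.mem_coe, this]
    tauto
  · exact Set.disjoint_left.1 hFJ hFtop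
  · exact fun hb => hb (hIJ hIbot)
  · exact fun x hx => Set.disjoint_left.1 hFJ hx
  · exact Set.disjoint_left.2 fun x hx hxI => hx (hIJ hxI)

section PrimeFilter

variable {A : ISAlg.{u}} {P : Set A.carrier}

theorem DMAlg.IsPrimeFilter.mem_of_le (hP : A.toDMAlg.IsPrimeFilter P) {x y : A.carrier}
    (h : A.meet x y = x) (hx : x ∈ P) : y ∈ P :=
  ((hP.meet x y).1 (h.symm ▸ hx)).2

theorem DMAlg.IsPrimeFilter.mem_nab (hP : A.toDMAlg.IsPrimeFilter P) (hA : IsInvolutiveStone A)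
    {x : A.carrier} (hx : x ∈ P) : A.nab x ∈ P :=
  hP.mem_of_le (hA.le_nab x) hx

/-- `∇x` is complemented, with complement `∼∇x`. -/
theorem DMAlg.IsPrimeFilter.mem_neg_nab (hP : A.toDMAlg.IsPrimeFilter P)
    (hA : IsInvolutiveStone A) (x : A.carrier) : A.neg (A.nab x) ∈ P ↔ A.nab x ∉ P := by
  constructor
  · intro h₁ h₂
    exact hP.bot (hA.neg_nab_meet_nab x ▸ (hP.meet _ _).2 ⟨h₁, h₂⟩)
  · intro h
    have e : A.join (A.neg (A.nab x)) (A.nab x) = A.top := by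
      rw [← hA.neg_bot, ← hA.neg_nab_meet_nab x, hA.neg_meet, hA.neg_neg, hA.join_comm]
    exact ((hP.join _ _).1 (e ▸ hP.top)).resolve_right h

theorem DMAlg.IsPrimeFilter.mem_nab_meet (hP : A.toDMAlg.IsPrimeFilter P)
    (hA : IsInvolutiveStone A) (x y : A.carrier) :
    A.nab (A.meet x y) ∈ P ↔ A.nab x ∈ P ∧ A.nab y ∈ P := by
  rw [hA.nab_meet, hP.meet]

theorem IsInvolutiveStone.meet_neg_nab (hA : IsInvolutiveStone A) (x : A.carrier) :
    A.meet x (A.neg (A.nab x)) = A.bot := by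
  rw [← hA.le_nab x, hA.meet_assoc, hA.le_nab, hA.meet_comm (A.nab x), hA.neg_nab_meet_nab,
    hA.meet_comm, hA.bot_meet]

theorem DMAlg.IsPrimeFilter.mem_nab_join (hP : A.toDMAlg.IsPrimeFilter P)
    (hA : IsInvolutiveStone A) (x y : A.carrier) :
    A.nab (A.join x y) ∈ P ↔ A.nab x ∈ P ∨ A.nab y ∈ P := by
  constructor
  · intro h
    by_contra! hn
    -- otherwise `P` contains `∇` of `(x ∨ y) ∧ ∼∇x ∧ ∼∇y`, which is `⊥`
    have hx := hP.mem_nab hA ((hP.mem_neg_nab hA x).2 hn.1)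
    have hy := hP.mem_nab hA ((hP.mem_neg_nab hA y).2 hn.2)
    have e : A.meet (A.meet (A.neg (A.nab x)) (A.neg (A.nab y))) (A.join x y) = A.bot := by
      rw [hA.meet_join_distrib, hA.meet_comm _ x, hA.meet_comm _ y, hA.meet_comm (A.neg (A.nab x)),
        ← hA.meet_assoc y, hA.meet_neg_nab, hA.meet_comm (A.neg (A.nab y)), ← hA.meet_assoc x,
        hA.meet_neg_nab, hA.bot_meet, hA.bot_meet]
      simpa only [hA.bot_meet] using hA.join_meet_self A.bot A.bot
    exact hP.bot (hA.nab_bot ▸ e ▸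
      (hP.mem_nab_meet hA _ _).2 ⟨(hP.mem_nab_meet hA _ _).2 ⟨hx, hy⟩, h⟩)
  · rintro (h | h)
    · have := hA.meet_join_self x y ▸ h
      exact ((hP.mem_nab_meet hA _ _).1 this).2
    · have := hA.meet_join_self y x ▸ h
      rw [hA.join_comm] at this
      exact ((hP.mem_nab_meet hA _ _).1 this).2

theorem DMAlg.IsPrimeFilter.mem_nab_neg_nab (hP : A.toDMAlg.IsPrimeFilter P)
    (hA : IsInvolutiveStone A) (x : A.carrier) : A.nab (A.neg (A.nab x)) ∈ P ↔ A.nab x ∉ P := by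
  constructor
  · intro h₁ h₂
    have := (hP.mem_nab_meet hA _ _).2 ⟨h₁, hP.mem_nab hA h₂⟩
    rw [hA.neg_nab_meet_nab, hA.nab_bot] at this
    exact hP.bot this
  · exact fun h => hP.mem_nab hA ((hP.mem_neg_nab hA x).2 h)

theorem DMAlg.IsPrimeFilter.mem_nab_nab (hP : A.toDMAlg.IsPrimeFilter P)
    (hA : IsInvolutiveStone A) (x : A.carrier) : A.nab (A.nab x) ∈ P ↔ A.nab x ∈ P := by
  refine ⟨fun h => ?_, hP.mem_nab hA⟩
  by_contra hn
  have := (hP.mem_nab_meet hA _ _).2 ⟨(hP.mem_nab_neg_nab hA x).2 hn, h⟩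
  rw [hA.neg_nab_meet_nab, hA.nab_bot] at this
  exact hP.bot this

theorem DMAlg.IsPrimeFilter.mem_neg_of_nab_notMem (hP : A.toDMAlg.IsPrimeFilter P)
    (hA : IsInvolutiveStone A) {x : A.carrier} (h : A.nab x ∉ P) : A.neg x ∈ P := by
  have := (hP.mem_neg_nab hA x).2 h
  rw [← hA.le_nab x, hA.neg_meet]
  exact (hP.join _ _).2 (.inr this)

end PrimeFilter

/-! ### The six-element algebra -/

theorem IS6_isInvolutiveStone : IsInvolutiveStone IS6 where
  meet_comm := by rintro (_ | _) (_ | _) <;> rfl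
  join_comm := by rintro (_ | _) (_ | _) <;> rfl
  meet_assoc := by rintro (_ | _) (_ | _) (_ | _) <;> rfl
  join_assoc := by rintro (_ | _) (_ | _) (_ | _) <;> rfl
  meet_join_self := by rintro (_ | _) (_ | _) <;> rfl
  join_meet_self := by rintro (_ | _) (_ | _) <;> rfl
  meet_join_distrib := by rintro (_ | _) (_ | _) (_ | _) <;> rfl
  bot_meet := by rintro (_ | _) <;> rfl
  meet_top := by rintro (_ | _) <;> rfl
  neg_join := by rintro (_ | _) (_ | _) <;> rfl
  neg_meet := by rintro (_ | _) (_ | _) <;> rfl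
  neg_neg := by rintro (_ | _) <;> rfl
  neg_top := rfl
  neg_bot := rfl
  nab_bot := rfl
  le_nab := by rintro (_ | _) <;> rfl
  nab_meet := by rintro (_ | _) (_ | _) <;> rfl
  neg_nab_meet_nab := by rintro (_ | _) <;> rfl

instance : DecidableEq IS6Carrier := fun x y => by
  cases x <;> cases y <;> first | exact isTrue rfl | exact isFalse nofun

instance : Fintype IS6Carrier := ⟨{.bbot, .zero, .a, .b, .one, .ttop}, by rintro (_ | _) <;> decide⟩

instance : DecidableEq IS6.carrier := inferInstanceAs (DecidableEq IS6Carrier)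

instance : Fintype IS6.carrier := inferInstanceAs (Fintype IS6Carrier)

instance (x y : IS6.carrier) : Decidable (x ∈ IS6.up y) :=
  inferInstanceAs (Decidable (IS6.meet y x = y))

/-- The element `a` of `IS₆`. -/
def IS6.a : IS6.carrier := IS6Carrier.a

/-- The element `b` of `IS₆`. -/
def IS6.b : IS6.carrier := IS6Carrier.b

/-- The coatom `1` of `IS₆`. -/
def IS6.one : IS6.carrier := IS6Carrier.one

theorem IS6_up_a_isPrimeFilter : IS6.IsPrimeFilter (IS6.up IS6.a) where
  meet := by decide
  join := by decide
  top := by decide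
  bot := by decide

/-- The element `z` of `IS₆` has the same position relative to `↑a` as `x` has relative to `P`. -/
structure SameType (A : ISAlg.{u}) (P : Set A.carrier) (x : A.carrier)
    (z : IS6.carrier) : Prop where
  mem : x ∈ P ↔ z ∈ IS6.up IS6.a
  neg : A.neg x ∈ P ↔ IS6.neg z ∈ IS6.up IS6.a
  nab : A.nab x ∈ P ↔ IS6.nab z ∈ IS6.up IS6.a
  nab_neg : A.nab (A.neg x) ∈ P ↔ IS6.nab (IS6.neg z) ∈ IS6.up IS6.a

theorem SameType.unique {A : ISAlg.{u}} {P : Set A.carrier} {x : A.carrier} {z w : IS6.carrier}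
    (h : SameType A P x z) (h' : SameType A P x w) : z = w := by
  have key : ∀ z w : IS6.carrier, (z ∈ IS6.up IS6.a ↔ w ∈ IS6.up IS6.a) →
      (IS6.neg z ∈ IS6.up IS6.a ↔ IS6.neg w ∈ IS6.up IS6.a) →
      (IS6.nab z ∈ IS6.up IS6.a ↔ IS6.nab w ∈ IS6.up IS6.a) →
      (IS6.nab (IS6.neg z) ∈ IS6.up IS6.a ↔ IS6.nab (IS6.neg w) ∈ IS6.up IS6.a) → z = w := by
    decide
  exact key z w (h.mem.symm.trans h'.mem) (h.neg.symm.trans h'.neg) (h.nab.symm.trans h'.nab)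
    (h.nab_neg.symm.trans h'.nab_neg)

theorem DMAlg.IsPrimeFilter.exists_sameType {A : ISAlg.{u}} {P : Set A.carrier}
    (hP : A.toDMAlg.IsPrimeFilter P) (hA : IsInvolutiveStone A) (x : A.carrier) :
    ∃ z, SameType A P x z := by
  have h₁ := fun h => hP.mem_nab hA (x := x) h
  have h₂ := fun h => hP.mem_nab hA (x := A.neg x) h
  have h₃ := fun h => hP.mem_neg_of_nab_notMem hA (x := x) h
  have h₄ := fun h => hP.mem_neg_of_nab_notMem hA (x := A.neg x) h
  rw [hA.neg_neg] at h₄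
  by_cases hn : A.nab x ∈ P
  · by_cases hm : A.nab (A.neg x) ∈ P
    · by_cases hp : x ∈ P <;> by_cases hq : A.neg x ∈ P
      · exact ⟨IS6.a, iff_of_true hp (by decide), iff_of_true hq (by decide),
          iff_of_true hn (by decide), iff_of_true hm (by decide)⟩
      · exact ⟨IS6.one, iff_of_true hp (by decide), iff_of_false hq (by decide),
          iff_of_true hn (by decide), iff_of_true hm (by decide)⟩
      · exact ⟨IS6.neg IS6.one, iff_of_false hp (by decide), iff_of_true hq (by decide),
          iff_of_true hn (by decide), iff_of_true hm (by decide)⟩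
      · exact ⟨IS6.b, iff_of_false hp (by decide), iff_of_false hq (by decide),
          iff_of_true hn (by decide), iff_of_true hm (by decide)⟩
    · exact ⟨IS6.top, iff_of_true (h₄ hm) (by decide), iff_of_false (mt h₂ hm) (by decide),
        iff_of_true hn (by decide), iff_of_false hm (by decide)⟩
  · exact ⟨IS6.bot, iff_of_false (mt h₁ hn) (by decide), iff_of_true (h₃ hn) (by decide),
      iff_of_false hn (by decide), iff_of_true (h₂ (h₃ hn)) (by decide)⟩

/-- Every prime filter of an involutive Stone algebra is the preimage of `↑a` under a
homomorphism to `IS₆`. Both `P` and `↑a` are prime filters, so that the position of a compound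
relative to them is computed from those of its components by the same laws. -/
theorem DMAlg.IsPrimeFilter.exists_isHom {A : ISAlg.{u}} {P : Set A.carrier}
    (hP : A.toDMAlg.IsPrimeFilter P) (hA : IsInvolutiveStone A) :
    ∃ f : A.carrier → IS6.carrier, ISAlg.IsHom f ∧
      ∀ x, x ∈ P ↔ f x ∈ IS6.up IS6.a := by
  choose f hf using hP.exists_sameType hA
  have hQ := IS6_up_a_isPrimeFilter
  have hB := IS6_isInvolutiveStone
  refine ⟨f, ⟨fun x y => ?_, fun x y => ?_, fun x => ?_, fun x => ?_, ?_, ?_⟩, fun x => (hf x).mem⟩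
  · refine (hf _).unique ⟨?_, ?_, ?_, ?_⟩
    · rw [hP.meet, hQ.meet, (hf x).mem, (hf y).mem]
    · rw [hA.neg_meet, hB.neg_meet, hP.join, hQ.join, (hf x).neg, (hf y).neg]
    · rw [hP.mem_nab_meet hA, hQ.mem_nab_meet hB, (hf x).nab, (hf y).nab]
    · rw [hA.neg_meet, hB.neg_meet, hP.mem_nab_join hA, hQ.mem_nab_join hB, (hf x).nab_neg,
        (hf y).nab_neg]
  · refine (hf _).unique ⟨?_, ?_, ?_, ?_⟩
    · rw [hP.join, hQ.join, (hf x).mem, (hf y).mem]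
    · rw [hA.neg_join, hB.neg_join, hP.meet, hQ.meet, (hf x).neg, (hf y).neg]
    · rw [hP.mem_nab_join hA, hQ.mem_nab_join hB, (hf x).nab, (hf y).nab]
    · rw [hA.neg_join, hB.neg_join, hP.mem_nab_meet hA, hQ.mem_nab_meet hB, (hf x).nab_neg,
        (hf y).nab_neg]
  · refine (hf _).unique ⟨(hf x).neg, ?_, (hf x).nab_neg, ?_⟩
    · rw [hA.neg_neg, hB.neg_neg, (hf x).mem]
    · rw [hA.neg_neg, hB.neg_neg, (hf x).nab]
  · refine (hf _).unique ⟨(hf x).nab, ?_, ?_, ?_⟩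
    · rw [hP.mem_neg_nab hA, hQ.mem_neg_nab hB, (hf x).nab]
    · rw [hP.mem_nab_nab hA, hQ.mem_nab_nab hB, (hf x).nab]
    · rw [hP.mem_nab_neg_nab hA, hQ.mem_nab_neg_nab hB, (hf x).nab]
  · have ht := hP.mem_nab hA hP.top
    have ht' := hQ.mem_nab hB hQ.top
    refine (hf _).unique ⟨iff_of_false hP.bot hQ.bot, ?_, ?_, ?_⟩
    · rw [hA.neg_bot, hB.neg_bot]; exact iff_of_true hP.top hQ.top
    · rw [hA.nab_bot, hB.nab_bot]; exact iff_of_false hP.bot hQ.bot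
    · rw [hA.neg_bot, hB.neg_bot]; exact iff_of_true ht ht'
  · have ht := hP.mem_nab hA hP.top
    have ht' := hQ.mem_nab hB hQ.top
    refine (hf _).unique ⟨iff_of_true hP.top hQ.top, ?_, iff_of_true ht ht', ?_⟩
    · rw [hA.neg_top, hB.neg_top]; exact iff_of_false hP.bot hQ.bot
    · rw [hA.neg_top, hB.neg_top, hA.nab_bot, hB.nab_bot]; exact iff_of_false hP.bot hQ.bot

/-! ### Consequence in `⟨IS₆, ↑a⟩` and the order of involutive Stone algebras -/

/-- The order between formulas given by the matrix `⟨IS₆, ↑a⟩`. By `FmLe.eval_le`, it is the order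
that holds identically in all involutive Stone algebras. -/
def FmLe (φ ψ : ISFm) : Prop :=
  ∀ v : ℕ → IS6.carrier, IS6.eval v φ ∈ IS6.up IS6.a → IS6.eval v ψ ∈ IS6.up IS6.a

theorem FmLe.eval_le {φ ψ : ISFm} (h : FmLe φ ψ) {A : ISAlg.{u}} (hA : IsInvolutiveStone A)
    (v : ℕ → A.carrier) : A.meet (A.eval v φ) (A.eval v ψ) = A.eval v φ := by
  let := hA.toIsDeMorgan.distribLattice
  by_contra hn
  rw [← hA.toIsDeMorgan.le_iff] at hn
  obtain ⟨P, hP, hF, hI⟩ := hA.toIsDeMorgan.exists_isPrimeFilter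
    (F := {x | A.eval v φ ≤ x}) (I := {x | x ≤ A.eval v ψ})
    ((hA.le_iff _ _).2 (hA.meet_top _)) (fun x hx y hy => le_inf (a := x) (b := y) hx hy)
    (fun x y hxy hx => le_trans hx ((hA.le_iff _ _).2 hxy))
    ((hA.le_iff _ _).2 (hA.bot_meet _)) (fun x hx y hy => sup_le (a := x) (b := y) hx hy)
    (fun x y hxy hy => le_trans ((hA.le_iff _ _).2 hxy) hy)
    (Set.disjoint_left.2 fun x hx hx' => hn (le_trans hx hx'))
  obtain ⟨f, hf, hfP⟩ := hP.exists_isHom hA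
  have h₁ := (hfP _).1 (hF (le_refl (A.eval v φ)))
  have h₂ := mt (hfP _).2 (Set.disjoint_right.1 hI (le_refl (A.eval v ψ)))
  rw [hf.eval] at h₁ h₂
  exact h₂ (h _ h₁)

/-- The algebra of functions from `X` to `A` with pointwise operations. -/
def ISAlg.pow (A : ISAlg.{u}) (X : Type v) : ISAlg.{max u v} where
  carrier := X → A.carrier
  meet f g x := A.meet (f x) (g x)
  join f g x := A.join (f x) (g x)
  neg f x := A.neg (f x)
  nab f x := A.nab (f x)
  bot _ := A.bot
  top _ := A.top

theorem IsInvolutiveStone.pow {A : ISAlg.{u}} (h : IsInvolutiveStone A) (X : Type v) :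
    IsInvolutiveStone (A.pow X) where
  meet_comm _ _ := funext fun _ => h.meet_comm _ _
  join_comm _ _ := funext fun _ => h.join_comm _ _
  meet_assoc _ _ _ := funext fun _ => h.meet_assoc _ _ _
  join_assoc _ _ _ := funext fun _ => h.join_assoc _ _ _
  meet_join_self _ _ := funext fun _ => h.meet_join_self _ _
  join_meet_self _ _ := funext fun _ => h.join_meet_self _ _
  meet_join_distrib _ _ _ := funext fun _ => h.meet_join_distrib _ _ _
  bot_meet _ := funext fun _ => h.bot_meet _
  meet_top _ := funext fun _ => h.meet_top _
  neg_join _ _ := funext fun _ => h.neg_join _ _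
  neg_meet _ _ := funext fun _ => h.neg_meet _ _
  neg_neg _ := funext fun _ => h.neg_neg _
  neg_top := funext fun _ => h.neg_top
  neg_bot := funext fun _ => h.neg_bot
  nab_bot := funext fun _ => h.nab_bot
  le_nab _ := funext fun _ => h.le_nab _
  nab_meet _ _ := funext fun _ => h.nab_meet _ _
  neg_nab_meet_nab _ := funext fun _ => h.neg_nab_meet_nab _

theorem ISAlg.pow_proj_isHom (A : ISAlg.{u}) (X : Type v) (x : X) :
    ISAlg.IsHom (A := A.pow X) (B := A) (fun f => f x) :=
  ⟨fun _ _ => rfl, fun _ _ => rfl, fun _ => rfl, fun _ => rfl, rfl, rfl⟩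

/-! ### Theories -/

/-- Theories of the order-preserving logic of involutive Stone algebras: nonempty sets of formulas
that are closed under finite meets and upward closed. -/
structure IsTheory (T : Set ISFm) : Prop where
  top : .top ∈ T
  meet : ∀ φ ∈ T, ∀ ψ ∈ T, .meet φ ψ ∈ T
  up : ∀ φ ψ, FmLe φ ψ → φ ∈ T → ψ ∈ T

theorem eval_meet_mem (v : ℕ → IS6.carrier) (φ ψ : ISFm) :
    IS6.eval v (.meet φ ψ) ∈ IS6.up IS6.a ↔
      IS6.eval v φ ∈ IS6.up IS6.a ∧ IS6.eval v ψ ∈ IS6.up IS6.a :=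
  IS6_up_a_isPrimeFilter.meet _ _

theorem eval_join_mem (v : ℕ → IS6.carrier) (φ ψ : ISFm) :
    IS6.eval v (.join φ ψ) ∈ IS6.up IS6.a ↔
      IS6.eval v φ ∈ IS6.up IS6.a ∨ IS6.eval v ψ ∈ IS6.up IS6.a :=
  IS6_up_a_isPrimeFilter.join _ _

theorem eval_neg_meet_mem (v : ℕ → IS6.carrier) (φ ψ : ISFm) :
    IS6.eval v (.neg (.meet φ ψ)) ∈ IS6.up IS6.a ↔
      IS6.eval v (.neg φ) ∈ IS6.up IS6.a ∨ IS6.eval v (.neg ψ) ∈ IS6.up IS6.a := by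
  rw [← eval_join_mem]
  exact iff_of_eq (congrArg (· ∈ IS6.up IS6.a) (IS6_isInvolutiveStone.neg_meet _ _))

theorem eval_bot_notMem (v : ℕ → IS6.carrier) : IS6.eval v .bot ∉ IS6.up IS6.a :=
  IS6_up_a_isPrimeFilter.bot

/-- A theory and a directed set of formulas disjoint from it are separated by a valuation in
`⟨IS₆, ↑a⟩`. The prime filter theorem is applied in the power of `IS₆` whose exponent is the set
of all valuations, where the variables are the projections. -/
theorem IsTheory.exists_valuation {T I : Set ISFm} (hT : IsTheory T) (hne : I.Nonempty)
    (hdir : ∀ φ ∈ I, ∀ ψ ∈ I, ∃ χ ∈ I, FmLe φ χ ∧ FmLe ψ χ) (hd : ∀ φ ∈ I, φ ∉ T) :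
    ∃ v : ℕ → IS6.carrier, (∀ φ ∈ T, IS6.eval v φ ∈ IS6.up IS6.a) ∧
      ∀ φ ∈ I, IS6.eval v φ ∉ IS6.up IS6.a := by
  let B := IS6.pow (ℕ → IS6.carrier)
  have hB : IsInvolutiveStone B := IS6_isInvolutiveStone.pow _
  let := hB.toIsDeMorgan.distribLattice
  let e : ISFm → B.carrier := B.eval fun n w => w n
  have he : ∀ φ w, e φ w = IS6.eval w φ := fun φ w =>
    (IS6.pow_proj_isHom _ w).eval _ φ
  have hle : ∀ φ ψ, FmLe φ ψ → e φ ≤ e ψ := fun φ ψ h => (hB.le_iff _ _).2 (h.eval_le hB _)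
  have hle' : ∀ φ ψ, e φ ≤ e ψ → FmLe φ ψ := fun φ ψ h w hφ => by
    have := congrFun ((hB.le_iff _ _).1 h) w
    refine IS6_up_a_isPrimeFilter.mem_of_le ?_ hφ
    rw [← he, ← he]
    exact this
  obtain ⟨P, hP, hF, hI⟩ := hB.toIsDeMorgan.exists_isPrimeFilter
    (F := {x | ∃ φ ∈ T, e φ ≤ x}) (I := {x | ∃ φ ∈ I, x ≤ e φ})
    ⟨.top, hT.top, (hB.le_iff _ _).2 (hB.meet_top _)⟩
    (fun x ⟨φ, hφ, hx⟩ y ⟨ψ, hψ, hy⟩ => ⟨.meet φ ψ, hT.meet φ hφ ψ hψ, inf_le_inf hx hy⟩)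
    (fun x y hxy ⟨φ, hφ, hx⟩ => ⟨φ, hφ, le_trans hx ((hB.le_iff _ _).2 hxy)⟩)
    (hne.imp fun φ hφ => ⟨hφ, (hB.le_iff _ _).2 (hB.bot_meet _)⟩)
    (fun x ⟨φ, hφ, hx⟩ y ⟨ψ, hψ, hy⟩ =>
      let ⟨χ, hχ, h₁, h₂⟩ := hdir φ hφ ψ hψ
      ⟨χ, hχ, sup_le (le_trans hx (hle _ _ h₁)) (le_trans hy (hle _ _ h₂))⟩)
    (fun x y hxy ⟨φ, hφ, hy⟩ => ⟨φ, hφ, le_trans ((hB.le_iff _ _).2 hxy) hy⟩)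
    (Set.disjoint_left.2 fun x ⟨φ, hφ, hx⟩ ⟨ψ, hψ, hx'⟩ =>
      hd ψ hψ (hT.up φ ψ (hle' _ _ (le_trans hx hx')) hφ))
  obtain ⟨f, hf, hfP⟩ := hP.exists_isHom hB
  have key : ∀ φ, IS6.eval (fun n => f fun w => w n) φ = f (e φ) := fun φ => (hf.eval _ φ).symm
  refine ⟨fun n => f fun w => w n, fun φ hφ => ?_, fun φ hφ => ?_⟩
  · rw [key, ← hfP]
    exact hF ⟨φ, hφ, le_refl _⟩
  · rw [key, ← hfP]
    exact Set.disjoint_right.1 hI ⟨φ, hφ, le_refl _⟩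

/-- For theories closed under disjunctive syllogism, separation by `⟨IS₆, ↑1⟩`. -/
theorem IsTheory.exists_valuation_of_ds {T : Set ISFm} (hT : IsTheory T)
    (hDS : ∀ α β, .meet α (.join (.neg α) β) ∈ T → β ∈ T) {φ : ISFm} (hφ : φ ∉ T) :
    ∃ v : ℕ → IS6.carrier,
      (∀ γ ∈ T, IS6.eval v γ ∈ IS6.up IS6.a ∧ IS6.eval v (.neg γ) ∉ IS6.up IS6.a) ∧
      IS6.eval v φ ∉ IS6.up IS6.a := by
  obtain ⟨v, hv, hv'⟩ := hT.exists_valuation (I := {χ | ∃ γ ∈ T, χ = .join (.neg γ) φ})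
    ⟨_, .top, hT.top, rfl⟩
    (by
      rintro _ ⟨γ, hγ, rfl⟩ _ ⟨δ, hδ, rfl⟩
      refine ⟨_, ⟨.meet γ δ, hT.meet γ hγ δ hδ, rfl⟩, fun v => ?_, fun v => ?_⟩ <;>
      · simp only [eval_join_mem, eval_neg_meet_mem]
        tauto)
    (by
      rintro _ ⟨γ, hγ, rfl⟩ h
      exact hφ (hDS γ φ (hT.meet _ hγ _ h)))
  have h := fun γ hγ => hv' _ ⟨γ, hγ, rfl⟩
  simp only [eval_join_mem, not_or] at h
  exact ⟨v, fun γ hγ => ⟨hv γ hγ, (h γ hγ).1⟩, (h .top hT.top).2⟩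

theorem IsTheory.exists_valuation_of_notMem {T : Set ISFm} (hT : IsTheory T) {φ : ISFm}
    (hφ : φ ∉ T) : ∃ v : ℕ → IS6.carrier, (∀ γ ∈ T, IS6.eval v γ ∈ IS6.up IS6.a) ∧
      IS6.eval v φ ∉ IS6.up IS6.a := by
  obtain ⟨v, hv, hv'⟩ := hT.exists_valuation (I := {φ}) ⟨φ, rfl⟩
    (by rintro _ rfl _ rfl; exact ⟨_, rfl, fun _ => id, fun _ => id⟩) (by rintro _ rfl; exact hφ)
  exact ⟨v, hv, hv' φ rfl⟩

/-- A theory closed under the rule `(K₁)` is separated from each formula outside it by a valuation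
for which no contradiction is designated. -/
theorem IsTheory.exists_valuation_of_k1 {T : Set ISFm} (hT : IsTheory T)
    (hK : ∀ α β, .join (.meet α (.neg α)) β ∈ T → β ∈ T) {φ : ISFm} (hφ : φ ∉ T) :
    ∃ v : ℕ → IS6.carrier, (∀ γ ∈ T, IS6.eval v γ ∈ IS6.up IS6.a) ∧
      IS6.eval v φ ∉ IS6.up IS6.a ∧
      ∀ α, ¬ (IS6.eval v α ∈ IS6.up IS6.a ∧ IS6.eval v (.neg α) ∈ IS6.up IS6.a) := by
  -- the ideal of all formulas that can be cancelled modulo `φ`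
  let I : Set ISFm := {χ | ∀ z, .join χ (.join φ z) ∈ T → .join φ z ∈ T}
  have hI : φ ∈ I := fun z => hT.up _ _ fun v => by simp only [eval_join_mem]; tauto
  have hc : ∀ α, .meet α (.neg α) ∈ I := fun α z => hK α _
  obtain ⟨v, hv, hv'⟩ := hT.exists_valuation (I := I) ⟨φ, hI⟩
    (by
      intro χ hχ ψ hψ
      refine ⟨.join χ ψ, fun z h => ?_, fun v => ?_, fun v => ?_⟩
      · have h₁ : .join χ (.join φ (.join ψ z)) ∈ T := hT.up _ _ (fun v => by
          simp only [eval_join_mem]; tauto) h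
        exact hψ z (hT.up _ _ (fun v => by simp only [eval_join_mem]; tauto) (hχ _ h₁))
      · simp only [eval_join_mem]; tauto
      · simp only [eval_join_mem]; tauto)
    (by
      intro χ hχ h
      have h₁ : .join φ .bot ∈ T := hχ .bot (hT.up _ _ (fun v => by
        simp only [eval_join_mem]; tauto) h)
      exact hφ (hT.up _ _ (fun v => by
        simp only [eval_join_mem]; exact fun h => h.resolve_right (eval_bot_notMem v)) h₁))
  refine ⟨v, hv, hv' φ hI, fun α => ?_⟩
  rw [← eval_meet_mem]
  exact hv' _ (hc α)

/-- A theory closed under the rule `(K_≤)` is separated from each formula outside it by a valuation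
for which either no contradiction is designated or all instances of excluded middle are. -/
theorem IsTheory.exists_valuation_of_kle {T : Set ISFm} (hT : IsTheory T)
    (hK : ∀ α β δ, .join (.meet α (.neg α)) δ ∈ T → .join (.join β (.neg β)) δ ∈ T)
    {φ : ISFm} (hφ : φ ∉ T) :
    ∃ v : ℕ → IS6.carrier, (∀ γ ∈ T, IS6.eval v γ ∈ IS6.up IS6.a) ∧
      IS6.eval v φ ∉ IS6.up IS6.a ∧
      ((∀ α, ¬ (IS6.eval v α ∈ IS6.up IS6.a ∧ IS6.eval v (.neg α) ∈ IS6.up IS6.a)) ∨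
        ∀ α, IS6.eval v α ∈ IS6.up IS6.a ∨ IS6.eval v (.neg α) ∈ IS6.up IS6.a) := by
  by_cases hE : ∀ β, .join (.join β (.neg β)) φ ∈ T
  · -- the formulas `χ` with `χ ∨ φ ∈ T` form a theory that contains excluded middle but not `φ`
    have hT' : IsTheory {χ | .join χ φ ∈ T} := by
      refine ⟨hT.up _ _ (fun v => ?_) hT.top, fun χ hχ ψ hψ =>
        hT.up _ _ (fun v => ?_) (hT.meet _ hχ _ hψ), fun χ ψ h => hT.up _ _ fun v => ?_⟩
      · simp only [eval_join_mem]; tauto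
      · simp only [eval_join_mem, eval_meet_mem]; tauto
      · simp only [eval_join_mem]; have := h v; tauto
    obtain ⟨v, hv, hv'⟩ := hT'.exists_valuation_of_notMem (φ := φ)
      (fun h => hφ (hT.up _ _ (fun v => by simp only [eval_join_mem]; tauto) h))
    refine ⟨v, fun γ hγ => hv γ (hT.up _ _ (fun v => ?_) hγ), hv', .inr fun α => ?_⟩
    · simp only [eval_join_mem]; tauto
    · rw [← eval_join_mem]; exact hv _ (hE α)
  · push Not at hE
    obtain ⟨β, hβ⟩ := hE
    -- `T` need not be closed under `(K₁)`, but contradictions can be traded for `β ∨ ∼β`, and so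
    -- be cancelled modulo `(β ∨ ∼β) ∨ φ`
    let I : Set ISFm :=
      {χ | ∀ z, .join χ (.join φ z) ∈ T → .join (.join β (.neg β)) (.join φ z) ∈ T}
    have hI : φ ∈ I := fun z => hT.up _ _ fun v => by simp only [eval_join_mem]; tauto
    have hc : ∀ α, .meet α (.neg α) ∈ I := fun α z => hK α β _
    obtain ⟨v, hv, hv'⟩ := hT.exists_valuation (I := I) ⟨φ, hI⟩
      (by
        intro χ hχ ψ hψ
        refine ⟨.join χ ψ, fun z h => ?_, fun v => ?_, fun v => ?_⟩
        · have h₁ : .join χ (.join φ (.join ψ z)) ∈ T := hT.up _ _ (fun v => by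
            simp only [eval_join_mem]; tauto) h
          have h₂ : .join ψ (.join φ (.join (.join β (.neg β)) z)) ∈ T :=
            hT.up _ _ (fun v => by simp only [eval_join_mem]; tauto) (hχ _ h₁)
          exact hT.up _ _ (fun v => by simp only [eval_join_mem]; tauto) (hψ _ h₂)
        · simp only [eval_join_mem]; tauto
        · simp only [eval_join_mem]; tauto)
      (by
        intro χ hχ h
        have h₁ := hχ .bot (hT.up _ _ (fun v => by simp only [eval_join_mem]; tauto) h)
        refine hβ (hT.up _ _ (fun v => ?_) h₁)
        have := eval_bot_notMem v
        simp only [eval_join_mem]; tauto)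
    refine ⟨v, hv, hv' φ hI, .inl fun α => ?_⟩
    rw [← eval_meet_mem]
    exact hv' _ (hc α)

/-! ### Valuations in subalgebras of `IS₆` -/

theorem mem_up_one_iff : ∀ x : IS6.carrier,
    x ∈ IS6.up IS6.one ↔ x ∈ IS6.up IS6.a ∧ IS6.neg x ∉ IS6.up IS6.a := by
  decide

theorem ISAlg.sub_val_isHom {A : ISAlg.{u}} {S : Set A.carrier} (h : A.IsClosed S)
    (hn : ∀ x ∈ S, A.nab x ∈ S) :
    ISAlg.IsHom (A := A.sub S h hn) (B := A) (fun x : S => x.1) :=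
  ⟨fun _ _ => rfl, fun _ _ => rfl, fun _ => rfl, fun _ => rfl, rfl, rfl⟩

/-- An inference valid in a subalgebra `S` with a principal up-set holds for all valuations in the
whole algebra that send the variables to `S`. -/
theorem ISLog_sub_apply {A : ISAlg.{u}} {S : Set A.carrier} (h : A.IsClosed S)
    (hn : ∀ x ∈ S, A.nab x ∈ S) {c : S} {Γ : Set ISFm} {φ : ISFm}
    (hL : ISLog {⟨A.sub S h hn, (A.sub S h hn).up c⟩} Γ φ) {v : ℕ → A.carrier}
    (hv : ∀ n, v n ∈ S) (hΓ : ∀ γ ∈ Γ, A.eval v γ ∈ A.up c.1) : A.eval v φ ∈ A.up c.1 := by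
  have key : ∀ ψ, (A.sub S h hn).eval (fun n => ⟨v n, hv n⟩) ψ ∈ (A.sub S h hn).up c ↔
      A.eval v ψ ∈ A.up c.1 := fun ψ => by
    have e := (ISAlg.sub_val_isHom h hn).eval (fun n => ⟨v n, hv n⟩) ψ
    change _ = A.eval v ψ at e
    rw [← e]
    exact Subtype.ext_iff
  exact (key φ).1 (hL _ rfl _ fun γ hγ => (key γ).2 (hΓ γ hγ))

instance decidableMemIS5Set (x : IS6Carrier) : Decidable (x ∈ IS5Set) :=
  inferInstanceAs (Decidable (x = .bbot ∨ x = .zero ∨ x = .a ∨ x = .one ∨ x = .ttop))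

instance decidableMemIS4Set (x : IS6Carrier) : Decidable (x ∈ IS4Set) :=
  inferInstanceAs (Decidable (x = .bbot ∨ x = .zero ∨ x = .one ∨ x = .ttop))

instance (x : IS6.carrier) : Decidable (x ∈ IS5Set) := decidableMemIS5Set x

instance (x : IS6.carrier) : Decidable (x ∈ IS4Set) := decidableMemIS4Set x

theorem mem_IS5Set_of_em : ∀ x : IS6.carrier,
    x ∈ IS6.up IS6.a ∨ IS6.neg x ∈ IS6.up IS6.a → x ∈ IS5Set := by
  decide

theorem mem_IS4Set_of_em : ∀ x : IS6.carrier,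
    x ∈ IS6.up IS6.a ∨ IS6.neg x ∈ IS6.up IS6.a →
    ¬ (x ∈ IS6.up IS6.a ∧ IS6.neg x ∈ IS6.up IS6.a) → x ∈ IS4Set := by
  decide

/-- The automorphism of `IS₆` that exchanges `a` and `b`. -/
def IS6.swap : IS6.carrier → IS6.carrier
  | .a => .b
  | .b => .a
  | x => x

theorem IS6.swap_isHom : ISAlg.IsHom (A := IS6) (B := IS6) IS6.swap where
  meet := by decide
  join := by decide
  neg := by decide
  nab := by decide
  bot := by decide
  top := by decide

theorem IS6.swap_mem_up_one : ∀ x, IS6.swap x ∈ IS6.up IS6.one ↔ x ∈ IS6.up IS6.one := by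
  decide

theorem IS6.swap_mem_IS5Set : ∀ x : IS6.carrier,
    ¬ (x ∈ IS6.up IS6.a ∧ IS6.neg x ∈ IS6.up IS6.a) → IS6.swap x ∈ IS5Set := by
  decide

/-- A valuation under which no contradiction takes a value in `↑a` avoids `a`, and exchanging `a`
and `b` turns it into a valuation in `⟨IS₅, ↑1⟩`. -/
theorem ISLog_IS5one_apply {Γ : Set ISFm} {φ : ISFm} (h : ISLog {matIS5one} Γ φ)
    {v : ℕ → IS6.carrier}
    (hv : ∀ α, ¬ (IS6.eval v α ∈ IS6.up IS6.a ∧ IS6.eval v (.neg α) ∈ IS6.up IS6.a))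
    (hΓ : ∀ γ ∈ Γ, IS6.eval v γ ∈ IS6.up IS6.a) : IS6.eval v φ ∈ IS6.up IS6.a := by
  have key := ISLog_sub_apply IS5Set_closed IS5Set_nab (c := IS5.one) h (v := IS6.swap ∘ v)
    (fun n => IS6.swap_mem_IS5Set _ (hv (.var n))) (fun γ hγ => by
      rw [← IS6.swap_isHom.eval]
      exact (IS6.swap_mem_up_one _).2
        ((mem_up_one_iff _).2 ⟨hΓ γ hγ, fun h' => hv γ ⟨hΓ γ hγ, h'⟩⟩))
  rw [← IS6.swap_isHom.eval] at key
  exact ((mem_up_one_iff _).1 ((IS6.swap_mem_up_one _).1 key)).1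

theorem ISLog_IS5a_apply {Γ : Set ISFm} {φ : ISFm} (h : ISLog {matIS5a} Γ φ)
    {v : ℕ → IS6.carrier}
    (hv : ∀ α, IS6.eval v α ∈ IS6.up IS6.a ∨ IS6.eval v (.neg α) ∈ IS6.up IS6.a)
    (hΓ : ∀ γ ∈ Γ, IS6.eval v γ ∈ IS6.up IS6.a) : IS6.eval v φ ∈ IS6.up IS6.a :=
  ISLog_sub_apply IS5Set_closed IS5Set_nab (c := IS5.a) h
    (fun n => mem_IS5Set_of_em _ (hv (.var n))) hΓ

/-! ### Completeness of the extensions of `IS_≤` -/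

theorem isTheory_of_isLogic {L : ISRel} (hL : IsLogic L)
    (hle : ∀ Δ ψ, ISle.{u} Δ ψ → L Δ ψ) (Γ : Set ISFm) : IsTheory {ψ | L Γ ψ} where
  top := hL.mono ∅ Γ _ (Set.empty_subset _) (hle _ _ (.inl ⟨rfl, fun _ _ _ => rfl⟩))
  meet φ hφ ψ hψ := by
    refine hL.cut Γ {φ, ψ} _ (by rintro _ (rfl | rfl) <;> assumption) (hle _ _ (.inr ?_))
    refine ⟨φ, [ψ], by simp, by simp, fun A (hA : IsInvolutiveStone A) v => ?_⟩
    exact FmLe.eval_le (φ := .meet φ ψ) (ψ := .meet φ ψ) (fun _ => id) hA v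
  up φ ψ h hφ := by
    refine hL.cut Γ {φ} _ (by rintro _ rfl; exact hφ) (hle _ _ (.inr ?_))
    exact ⟨φ, [], by simp, by simp, fun A (hA : IsInvolutiveStone A) v => h.eval_le hA v⟩

theorem IsLogic.closed {L : ISRel} (hL : IsLogic L) {Γ Δ : Set ISFm} {ψ : ISFm} (h : L Δ ψ)
    (σ : ℕ → ISFm) (hΔ : ∀ δ ∈ Δ, L Γ (δ.subst σ)) : L Γ (ψ.subst σ) :=
  hL.cut Γ _ _ (by rintro _ ⟨δ, hδ, rfl⟩; exact hΔ δ hδ) (hL.structural σ _ _ h)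

/-- The substitution that replaces the first three variables. -/
def subst₃ (α β δ : ISFm) : ℕ → ISFm
  | 0 => α
  | 1 => β
  | _ => δ

theorem IsLogic.ds {L : ISRel} (hL : IsLogic L) {Γ : Set ISFm} (h : L ruleDS.1 ruleDS.2)
    (α β : ISFm)
    (hΓ : L Γ (.meet α (.join (.neg α) β))) : L Γ β :=
  hL.closed h (subst₃ α β β) (by rintro _ rfl; exact hΓ)

theorem IsLogic.k1 {L : ISRel} (hL : IsLogic L) {Γ : Set ISFm} (h : L ruleK1.1 ruleK1.2)
    (α β : ISFm)
    (hΓ : L Γ (.join (.meet α (.neg α)) β)) : L Γ β :=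
  hL.closed h (subst₃ α β β) (by rintro _ rfl; exact hΓ)

theorem IsLogic.kle {L : ISRel} (hL : IsLogic L) {Γ : Set ISFm} (h : L ruleKle.1 ruleKle.2)
    (α β δ : ISFm)
    (hΓ : L Γ (.join (.meet α (.neg α)) δ)) : L Γ (.join (.join β (.neg β)) δ) :=
  hL.closed h (subst₃ α β δ) (by rintro _ rfl; exact hΓ)

theorem IsLogic.em {L : ISRel} (hL : IsLogic L) {Γ : Set ISFm} (h : L ruleEM.1 ruleEM.2)
    (α : ISFm) : L Γ (.join α (.neg α)) :=
  hL.closed h (subst₃ α α α) (by rintro _ ⟨⟩)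

theorem extend_of_ISLog_IS6one {Γ : Set ISFm} {φ : ISFm} (h : ISLog {matIS6one} Γ φ) :
    extend ISle.{u} {ruleDS} Γ φ := by
  intro L hL hle hR
  by_contra hφ
  obtain ⟨v, hv, hv'⟩ := (isTheory_of_isLogic hL hle Γ).exists_valuation_of_ds
    (fun α β => hL.ds (hR _ rfl) α β) hφ
  exact hv' ((mem_up_one_iff _).1
    (h _ rfl v fun γ hγ => (mem_up_one_iff _).2 (hv γ (hL.refl _ _ hγ)))).1

theorem extend_of_ISLog_IS5a {Γ : Set ISFm} {φ : ISFm} (h : ISLog {matIS5a} Γ φ) :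
    extend ISle.{u} {ruleEM} Γ φ := by
  intro L hL hle hR
  by_contra hφ
  obtain ⟨v, hv, hv'⟩ := (isTheory_of_isLogic hL hle Γ).exists_valuation_of_notMem hφ
  exact hv' (ISLog_IS5a_apply h
    (fun α => (eval_join_mem v _ _).1 (hv _ (hL.em (hR _ rfl) α)))
    fun γ hγ => hv γ (hL.refl _ _ hγ))

theorem extend_of_ISLog_IS5one {Γ : Set ISFm} {φ : ISFm} (h : ISLog {matIS5one} Γ φ) :
    extend ISle.{u} {ruleK1} Γ φ := by
  intro L hL hle hR
  by_contra hφ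
  obtain ⟨v, hv, hv', hc⟩ := (isTheory_of_isLogic hL hle Γ).exists_valuation_of_k1
    (fun α β => hL.k1 (hR _ rfl) α β) hφ
  exact hv' (ISLog_IS5one_apply h hc fun γ hγ => hv γ (hL.refl _ _ hγ))

theorem extend_of_ISLog_IS5 {Γ : Set ISFm} {φ : ISFm} (h : ISLog {matIS5a, matIS5one} Γ φ) :
    extend ISle.{u} {ruleKle} Γ φ := by
  intro L hL hle hR
  by_contra hφ
  obtain ⟨v, hv, hv', hc | hc⟩ := (isTheory_of_isLogic hL hle Γ).exists_valuation_of_kle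
    (fun α β δ => hL.kle (hR _ rfl) α β δ) hφ
  · exact hv' (ISLog_IS5one_apply (by rintro _ rfl; exact h _ (.inr rfl)) hc
      fun γ hγ => hv γ (hL.refl _ _ hγ))
  · exact hv' (ISLog_IS5a_apply (by rintro _ rfl; exact h _ (.inl rfl)) hc
      fun γ hγ => hv γ (hL.refl _ _ hγ))

theorem extend_of_ISLog_IS4one {Γ : Set ISFm} {φ : ISFm} (h : ISLog {matIS4one} Γ φ) :
    extend ISle.{u} {ruleDS, ruleEM} Γ φ := by
  intro L hL hle hR
  by_contra hφ
  obtain ⟨v, hv, hv'⟩ := (isTheory_of_isLogic hL hle Γ).exists_valuation_of_ds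
    (fun α β => hL.ds (hR _ (.inl rfl)) α β) hφ
  have hem := fun α => hv _ (hL.em (hR _ (.inr rfl)) α)
  -- excluded middle excludes the value `b`; its negation is not in `↑a`, which excludes `a`
  have key := ISLog_sub_apply IS4Set_closed IS4Set_nab (c := IS4.one) h (v := v)
    (fun n => mem_IS4Set_of_em _ ((eval_join_mem v _ _).1 (hem (.var n)).1) fun hn => by
      refine (hem (.var n)).2 ?_
      have e : IS6.eval v (.neg (.join (.var n) (.neg (.var n)))) =
          IS6.meet (IS6.neg (v n)) (IS6.neg (IS6.neg (v n))) := IS6_isInvolutiveStone.neg_join _ _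
      rw [e, IS6_isInvolutiveStone.neg_neg]
      exact (IS6_up_a_isPrimeFilter.meet _ _).2 ⟨hn.2, hn.1⟩)
    fun γ hγ => (mem_up_one_iff _).2 (hv γ (hL.refl _ _ hγ))
  exact hv' ((mem_up_one_iff _).1 key).1

/-! ### The algebras `A^∇` -/

theorem IsDeMorgan.meet_self {A : DMAlg.{u}} (h : IsDeMorgan A) (x : A.carrier) :
    A.meet x x = x :=
  let := h.distribLattice
  inf_idem x

theorem IsDeMorgan.join_self {A : DMAlg.{u}} (h : IsDeMorgan A) (x : A.carrier) :
    A.join x x = x :=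
  let := h.distribLattice
  sup_idem x

theorem IsDeMorgan.meet_join_self' {A : DMAlg.{u}} (h : IsDeMorgan A) (x y : A.carrier) :
    A.join (A.meet x y) x = x := by
  rw [h.join_comm, h.join_meet_self]

theorem IsDeMorgan.nabla {A : DMAlg.{u}} (h : IsDeMorgan A) : IsInvolutiveStone A.nabla where
  meet_comm := by
    rintro (_ | x | _) (_ | y | _) <;> first | rfl | exact congrArg Adjoin.of (h.meet_comm _ _)
  join_comm := by
    rintro (_ | x | _) (_ | y | _) <;> first | rfl | exact congrArg Adjoin.of (h.join_comm _ _)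
  meet_assoc := by
    rintro (_ | x | _) (_ | y | _) (_ | z | _) <;>
      first | rfl | exact congrArg Adjoin.of (h.meet_assoc _ _ _)
  join_assoc := by
    rintro (_ | x | _) (_ | y | _) (_ | z | _) <;>
      first | rfl | exact congrArg Adjoin.of (h.join_assoc _ _ _)
  meet_join_self := by
    rintro (_ | x | _) (_ | y | _) <;>
      first
      | rfl
      | exact congrArg Adjoin.of (h.meet_join_self _ _)
      | exact congrArg Adjoin.of (h.meet_self _)
  join_meet_self := by
    rintro (_ | x | _) (_ | y | _) <;>
      first
      | rfl
      | exact congrArg Adjoin.of (h.join_meet_self _ _)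
      | exact congrArg Adjoin.of (h.join_self _)
  meet_join_distrib := by
    rintro (_ | x | _) (_ | y | _) (_ | z | _) <;>
      first
      | rfl
      | exact congrArg Adjoin.of (h.meet_join_distrib _ _ _)
      | exact congrArg Adjoin.of (h.join_self _).symm
      | exact congrArg Adjoin.of (h.join_meet_self _ _).symm
      | exact congrArg Adjoin.of (h.meet_join_self' _ _).symm
  bot_meet := by rintro (_ | x | _) <;> rfl
  meet_top := by rintro (_ | x | _) <;> rfl
  neg_join := by
    rintro (_ | x | _) (_ | y | _) <;> first | rfl | exact congrArg Adjoin.of (h.neg_join _ _)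
  neg_meet := by
    rintro (_ | x | _) (_ | y | _) <;> first | rfl | exact congrArg Adjoin.of (h.neg_meet _ _)
  neg_neg := by
    rintro (_ | x | _) <;> first | rfl | exact congrArg Adjoin.of (h.neg_neg _)
  neg_top := rfl
  neg_bot := rfl
  nab_bot := rfl
  le_nab := by rintro (_ | x | _) <;> rfl
  nab_meet := by rintro (_ | x | _) (_ | y | _) <;> rfl
  neg_nab_meet_nab := by rintro (_ | x | _) <;> rfl

/-! ### Reduced models are De Morgan algebras -/

/-- Uniform substitution in the De Morgan language. -/
def DMFm.subst (σ : ℕ → DMFm) : DMFm → DMFm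
  | .var n => σ n
  | .meet φ ψ => .meet (φ.subst σ) (ψ.subst σ)
  | .join φ ψ => .join (φ.subst σ) (ψ.subst σ)
  | .neg φ => .neg (φ.subst σ)
  | .bot => .bot
  | .top => .top

theorem DMAlg.eval_subst (A : DMAlg.{u}) (v : ℕ → A.carrier) (σ : ℕ → DMFm) (φ : DMFm) :
    A.eval v (φ.subst σ) = A.eval (fun n => A.eval v (σ n)) φ := by
  induction φ with
  | var n => rfl
  | meet φ ψ h₁ h₂ => simp only [DMAlg.eval, DMFm.subst, h₁, h₂]
  | join φ ψ h₁ h₂ => simp only [DMAlg.eval, DMFm.subst, h₁, h₂]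
  | neg φ h => simp only [DMAlg.eval, DMFm.subst, h]
  | bot => rfl
  | top => rfl

/-- The sequence `a, v 0, v 1, …`. -/
def consVal {α : Type u} (a : α) (v : ℕ → α) : ℕ → α
  | 0 => a
  | n + 1 => v n

/-- The Leibniz congruence of a matrix: `a` and `b` are related when no polynomial in the first
variable, with parameters for the other variables, distinguishes them. -/
def DMMatrix.leibniz (M : DMMatrix.{u}) : Setoid M.alg.carrier where
  r a b := ∀ (φ : DMFm) (v : ℕ → M.alg.carrier),
    M.alg.eval (consVal a v) φ ∈ M.D ↔ M.alg.eval (consVal b v) φ ∈ M.D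
  iseqv := ⟨fun _ _ _ => Iff.rfl, fun h φ v => (h φ v).symm, fun h h' φ v => (h φ v).trans (h' φ v)⟩

/-- The Leibniz congruence is preserved by polynomials. The parameters of the two polynomials that
are composed are kept apart by a bijection `ℕ ⊕ ℕ ≃ ℕ`. -/
theorem DMMatrix.leibniz_eval (M : DMMatrix.{u}) {a b : M.alg.carrier} (h : M.leibniz a b)
    (τ : DMFm) (w : ℕ → M.alg.carrier) :
    M.leibniz (M.alg.eval (consVal a w) τ) (M.alg.eval (consVal b w) τ) := by
  intro φ v
  let e := Equiv.natSumNatEquivNat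
  let σ : ℕ → DMFm := consVal (τ.subst (consVal (.var 0) fun n => .var (e (.inl n) + 1)))
    fun n => .var (e (.inr n) + 1)
  have key : ∀ c, M.alg.eval (consVal c fun n => Sum.elim w v (e.symm n)) (φ.subst σ) =
      M.alg.eval (consVal (M.alg.eval (consVal c w) τ) v) φ := by
    intro c
    rw [DMAlg.eval_subst]
    congr 1
    funext n
    cases n with
    | zero =>
      simp only [σ, consVal, DMAlg.eval_subst]
      congr 1
      funext n
      cases n with
      | zero => rfl
      | succ n => simp [consVal, DMAlg.eval]
    | succ n => simp [σ, consVal, DMAlg.eval]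
  rw [← key, ← key]
  exact h _ _

theorem DMMatrix.leibniz_isCongruence (M : DMMatrix.{u}) : M.alg.IsCongruence M.leibniz where
  meet _ x' y _ hx hy := M.leibniz.trans
    (M.leibniz_eval hx (.meet (.var 0) (.var 1)) fun _ => y)
    (M.leibniz_eval hy (.meet (.var 1) (.var 0)) fun _ => x')
  join _ x' y _ hx hy := M.leibniz.trans
    (M.leibniz_eval hx (.join (.var 0) (.var 1)) fun _ => y)
    (M.leibniz_eval hy (.join (.var 1) (.var 0)) fun _ => x')
  neg x _ hx := M.leibniz_eval hx (.neg (.var 0)) fun _ => x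

/-- Logics that contain the order of De Morgan algebras and whose theories are closed under meets.
The universe `w` is that of the algebras that determine the order. -/
structure IsDeMorganLogic (L : DMRel) : Prop where
  meet : ∀ φ ψ, L {φ, ψ} (.meet φ ψ)
  le : ∀ φ ψ, (∀ A : DMAlg.{w}, IsDeMorgan A → ∀ v : ℕ → A.carrier,
    A.meet (A.eval v φ) (A.eval v ψ) = A.eval v φ) → L {φ} ψ

/-- An identity of De Morgan algebras holds in every reduced model, because replacing one side by
the other inside a formula yields an interderivable formula. -/
theorem DMMatrix.IsReduced.eval_eq {M : DMMatrix.{u}} {L : DMRel} (hL : IsDeMorganLogic.{w} L)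
    (hM : M.IsModel L) (hr : M.IsReduced) {s t : DMFm}
    (hst : ∀ A : DMAlg.{w}, IsDeMorgan A → ∀ v : ℕ → A.carrier, A.eval v s = A.eval v t)
    (v : ℕ → M.alg.carrier) : M.alg.eval v s = M.alg.eval v t := by
  refine hr M.leibniz M.leibniz_isCongruence (fun x y h => (h (.var 0) fun _ => x).1) _ _ ?_
  have aux : ∀ {s t : DMFm},
      (∀ A : DMAlg.{w}, IsDeMorgan A → ∀ v : ℕ → A.carrier, A.eval v s = A.eval v t) →
      ∀ (φ : DMFm) (w : ℕ → M.alg.carrier), M.alg.eval (consVal (M.alg.eval v s) w) φ ∈ M.D →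
        M.alg.eval (consVal (M.alg.eval v t) w) φ ∈ M.D := by
    intro s t hst φ w
    let e := Equiv.natSumNatEquivNat
    let σ : DMFm → ℕ → DMFm := fun s =>
      consVal (s.subst fun n => .var (e (.inl n))) fun n => .var (e (.inr n))
    have key : ∀ s : DMFm, M.alg.eval (fun n => Sum.elim v w (e.symm n)) (φ.subst (σ s)) =
        M.alg.eval (consVal (M.alg.eval v s) w) φ := by
      intro s
      rw [DMAlg.eval_subst]
      congr 1
      funext n
      cases n with
      | zero => simp [σ, consVal, DMAlg.eval_subst, DMAlg.eval]
      | succ n => simp [σ, consVal, DMAlg.eval]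
    rw [← key, ← key]
    intro h
    refine hM {φ.subst (σ s)} (φ.subst (σ t)) (hL.le _ _ fun A hA v => ?_) M rfl _
      (by rintro _ rfl; exact h)
    have : A.eval v (φ.subst (σ s)) = A.eval v (φ.subst (σ t)) := by
      rw [DMAlg.eval_subst, DMAlg.eval_subst]
      congr 1
      funext n
      cases n with
      | zero => simp only [σ, consVal, DMAlg.eval_subst, hst A hA]
      | succ n => rfl
    rw [this, hA.meet_self]
  exact fun φ w => ⟨aux hst φ w, aux (fun A hA v => (hst A hA v).symm) φ w⟩

theorem DMMatrix.IsReduced.isDeMorgan {M : DMMatrix.{u}} {L : DMRel}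
    (hL : IsDeMorganLogic.{w} L) (hM : M.IsModel L) (hr : M.IsReduced) : IsDeMorgan M.alg := by
  let X : DMFm := .var 0
  let Y : DMFm := .var 1
  let Z : DMFm := .var 2
  have key : ∀ (s t : DMFm), (∀ A : DMAlg.{w}, IsDeMorgan A → ∀ v : ℕ → A.carrier,
      A.eval v s = A.eval v t) → ∀ x y z : M.alg.carrier,
      M.alg.eval (consVal x (consVal y fun _ => z)) s =
        M.alg.eval (consVal x (consVal y fun _ => z)) t :=
    fun s t hst x y z => hr.eval_eq hL hM hst _
  exact {
    meet_comm := fun x y => key (X.meet Y) (Y.meet X) (fun A h v => h.meet_comm _ _) x y y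
    join_comm := fun x y => key (X.join Y) (Y.join X) (fun A h v => h.join_comm _ _) x y y
    meet_assoc := key ((X.meet Y).meet Z) (X.meet (Y.meet Z)) fun A h v => h.meet_assoc _ _ _
    join_assoc := key ((X.join Y).join Z) (X.join (Y.join Z)) fun A h v => h.join_assoc _ _ _
    meet_join_self := fun x y =>
      key (X.meet (X.join Y)) X (fun A h v => h.meet_join_self _ _) x y y
    join_meet_self := fun x y =>
      key (X.join (X.meet Y)) X (fun A h v => h.join_meet_self _ _) x y y
    meet_join_distrib := key (X.meet (Y.join Z)) ((X.meet Y).join (X.meet Z))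
      fun A h v => h.meet_join_distrib _ _ _
    bot_meet := fun x => key (.meet .bot X) .bot (fun A h v => h.bot_meet _) x x x
    meet_top := fun x => key (X.meet .top) X (fun A h v => h.meet_top _) x x x
    neg_join := fun x y =>
      key (.neg (X.join Y)) (X.neg.meet Y.neg) (fun A h v => h.neg_join _ _) x y y
    neg_meet := fun x y =>
      key (.neg (X.meet Y)) (X.neg.join Y.neg) (fun A h v => h.neg_meet _ _) x y y
    neg_neg := fun x => key X.neg.neg X (fun A h v => h.neg_neg _) x x x
    neg_top := key (.neg .top) .bot (fun A h v => h.neg_top) M.alg.top M.alg.top M.alg.top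
    neg_bot := key (.neg .bot) .top (fun A h v => h.neg_bot) M.alg.top M.alg.top M.alg.top }

/-! ### Soundness of the extensions of `IS_≤` -/

/-- The nontrivial reduced models of `L`. -/
structure DMMatrix.IsProperModel (M : DMMatrix.{u}) (L : DMRel) : Prop where
  isModel : M.IsModel L
  isReduced : M.IsReduced
  ne_univ : M.D ≠ Set.univ

section Soundness

variable {M : DMMatrix.{u}} {L : DMRel}

theorem DMMatrix.IsModel.meet_mem (hM : M.IsModel L) (hL : IsDeMorganLogic.{w} L)
    {x y : M.alg.carrier} (hx : x ∈ M.D) (hy : y ∈ M.D) : M.alg.meet x y ∈ M.D :=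
  hM _ _ (hL.meet (.var 0) (.var 1)) M rfl (consVal x fun _ => y) (by
    rintro _ (rfl | rfl) <;> assumption)

theorem DMMatrix.IsModel.mem_of_le (hM : M.IsModel L) (hL : IsDeMorganLogic.{w} L)
    {x y : M.alg.carrier} (h : M.alg.meet x y = x) (hx : x ∈ M.D) : y ∈ M.D :=
  hM {.meet (.var 0) (.var 1)} (.var 1) (hL.le _ _ fun A hA v => by
    simp only [DMAlg.eval]
    rw [hA.meet_assoc, hA.meet_self]) M rfl (consVal x fun _ => y) (by
    rintro _ rfl
    change M.alg.meet x y ∈ M.D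
    rwa [h])

theorem DMMatrix.mem_nabla (M : DMMatrix.{u}) (x : M.alg.carrier) :
    Adjoin.of x ∈ M.nabla.D ↔ x ∈ M.D :=
  ⟨fun h => h.elim (fun ⟨_, hy, e⟩ => Adjoin.of.inj e ▸ hy) nofun, fun h => .inl ⟨x, h, rfl⟩⟩

theorem DMMatrix.ttop_mem_nabla (M : DMMatrix.{u}) : Adjoin.ttop ∈ M.nabla.D := .inr rfl

theorem DMMatrix.bbot_notMem_nabla (M : DMMatrix.{u}) : Adjoin.bbot ∉ M.nabla.D :=
  fun h => h.elim nofun nofun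

theorem DMMatrix.IsProperModel.nabla_meet_mem (hM : M.IsProperModel L)
    (hL : IsDeMorganLogic.{w} L) : ∀ x y : M.nabla.alg.carrier,
      x ∈ M.nabla.D → y ∈ M.nabla.D → M.nabla.alg.meet x y ∈ M.nabla.D := by
  rintro (_ | x | _) (_ | y | _) hx hy <;> first
    | exact absurd hx M.bbot_notMem_nabla
    | exact absurd hy M.bbot_notMem_nabla
    | assumption
    | skip
  exact (M.mem_nabla _).2
    (hM.isModel.meet_mem hL ((M.mem_nabla _).1 hx) ((M.mem_nabla _).1 hy))

theorem DMMatrix.IsProperModel.nabla_mem_of_le (hM : M.IsProperModel L)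
    (hL : IsDeMorganLogic.{w} L) : ∀ x y : M.nabla.alg.carrier,
      M.nabla.alg.meet x y = x → x ∈ M.nabla.D → y ∈ M.nabla.D := by
  rintro x (_ | y | _) h hx
  · rcases x with _ | x | _
    · exact hx
    · cases (show Adjoin.bbot = Adjoin.of x from h)
    · cases (show Adjoin.bbot = (Adjoin.ttop : Adjoin M.alg.carrier) from h)
  · rcases x with _ | x | _
    · exact absurd hx M.bbot_notMem_nabla
    · exact (M.mem_nabla _).2
        (hM.isModel.mem_of_le hL (Adjoin.of.inj h) ((M.mem_nabla _).1 hx))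
    · cases (show Adjoin.of y = Adjoin.ttop from h)
  · exact M.ttop_mem_nabla

/-- `M^∇` is a model of `IS_≤`: its algebra is an involutive Stone algebra and its designated
elements form a filter. -/
theorem DMMatrix.IsProperModel.ISle_le (hM : M.IsProperModel L) (hL : IsDeMorganLogic.{w} L)
    {Γ : Set ISFm} {φ : ISFm} (h : ISle.{u} Γ φ) : ISLog {M.nabla} Γ φ := by
  have hA : IsInvolutiveStone M.nabla.alg := (hM.isReduced.isDeMorgan hL hM.isModel).nabla
  rintro _ rfl v hv
  rcases h with ⟨-, h⟩ | ⟨γ, l, hγ, hl, h⟩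
  · rw [h _ hA]
    exact M.ttop_mem_nabla
  · refine hM.nabla_mem_of_le hL _ _ (h _ hA v) ?_
    have key : ∀ (l : List ISFm) (γ : ISFm), M.nabla.alg.eval v γ ∈ M.nabla.D →
        (∀ ψ ∈ l, ψ ∈ Γ) → M.nabla.alg.eval v (l.foldl .meet γ) ∈ M.nabla.D := by
      intro l
      induction l with
      | nil => exact fun γ hγ _ => hγ
      | cons ψ l ih =>
        intro γ hγ hl
        exact ih (.meet γ ψ)
          (hM.nabla_meet_mem hL _ _ hγ (hv ψ (hl ψ (by simp)))) fun χ hχ => hl χ (by simp [hχ])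
    exact key l γ (hv γ hγ) hl

theorem nablaLogic_of_extend (hL : IsDeMorganLogic.{w} L) {R : Set (Set ISFm × ISFm)}
    (hR : ∀ M : DMMatrix.{u}, M.IsProperModel L → ∀ ρ ∈ R, ISLog {M.nabla} ρ.1 ρ.2)
    {Γ : Set ISFm} {φ : ISFm} (h : extend ISle.{u} R Γ φ) : nablaLogic.{u} L Γ φ := by
  refine h _ (ISLog_isLogic _) (fun Δ ψ hΔ => ?_) fun ρ hρ => ?_
  · rintro _ ⟨M, h₁, h₂, h₃, rfl⟩
    exact (DMMatrix.IsProperModel.mk h₁ h₂ h₃).ISle_le hL hΔ _ rfl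
  · rintro _ ⟨M, h₁, h₂, h₃, rfl⟩
    exact hR M ⟨h₁, h₂, h₃⟩ ρ hρ _ rfl

/-- In a nontrivial model of an explosive logic no contradiction is designated. -/
theorem DMMatrix.IsProperModel.not_contradiction (hM : M.IsProperModel L)
    (h : L {.meet (.var 0) (.neg (.var 0))} (.var 1)) (x : M.alg.carrier) :
    M.alg.meet x (M.alg.neg x) ∉ M.D := fun hx =>
  hM.ne_univ (Set.eq_univ_of_forall fun y =>
    hM.isModel _ _ h M rfl (consVal x fun _ => y) (by rintro _ rfl; exact hx))

theorem DMMatrix.IsProperModel.nabla_ds (hM : M.IsProperModel L)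
    (h : L {.meet (.var 0) (.neg (.var 0))} (.var 1))
    (h' : L {.meet (.var 0) (.join (.neg (.var 0)) (.var 1))} (.var 1)) :
    ISLog {M.nabla} ruleDS.1 ruleDS.2 := by
  rintro _ rfl v hv
  have hv := hv _ rfl
  change M.nabla.alg.meet (v 0) (M.nabla.alg.join (M.nabla.alg.neg (v 0)) (v 1)) ∈ _ at hv
  change v 1 ∈ _
  generalize v 0 = x at hv
  generalize v 1 = y at hv ⊢
  rcases x with _ | x | _ <;> rcases y with _ | y | _ <;> first
    | exact absurd hv M.bbot_notMem_nabla
    | exact M.ttop_mem_nabla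
    | exact hv
    | skip
  · exact absurd ((M.mem_nabla _).1 hv) (hM.not_contradiction h x)
  · exact (M.mem_nabla _).2 (hM.isModel _ _ h' M rfl (consVal x fun _ => y)
      (by rintro _ rfl; exact (M.mem_nabla _).1 hv))

theorem DMMatrix.IsProperModel.nabla_k1 (hM : M.IsProperModel L)
    (h : L {.meet (.var 0) (.neg (.var 0))} (.var 1))
    (h' : L {.join (.meet (.var 0) (.neg (.var 0))) (.var 1)} (.var 1)) :
    ISLog {M.nabla} ruleK1.1 ruleK1.2 := by
  rintro _ rfl v hv
  have hv := hv _ rfl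
  change M.nabla.alg.join (M.nabla.alg.meet (v 0) (M.nabla.alg.neg (v 0))) (v 1) ∈ _ at hv
  change v 1 ∈ _
  generalize v 0 = x at hv
  generalize v 1 = y at hv ⊢
  rcases x with _ | x | _ <;> rcases y with _ | y | _ <;> first
    | exact absurd hv M.bbot_notMem_nabla
    | exact M.ttop_mem_nabla
    | exact hv
    | skip
  · exact absurd ((M.mem_nabla _).1 hv) (hM.not_contradiction h x)
  · exact (M.mem_nabla _).2 (hM.isModel _ _ h' M rfl (consVal x fun _ => y)
      (by rintro _ rfl; exact (M.mem_nabla _).1 hv))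

theorem DMMatrix.IsProperModel.nabla_kle (hM : M.IsProperModel L) (hL : IsDeMorganLogic.{w} L)
    (h : L {.meet (.var 0) (.neg (.var 0))} (.join (.var 1) (.neg (.var 1))))
    (h' : L {.join (.meet (.var 0) (.neg (.var 0))) (.var 2)}
      (.join (.join (.var 1) (.neg (.var 1))) (.var 2))) :
    ISLog {M.nabla} ruleKle.1 ruleKle.2 := by
  rintro _ rfl v hv
  have hv := hv _ rfl
  change M.nabla.alg.join (M.nabla.alg.meet (v 0) (M.nabla.alg.neg (v 0))) (v 2) ∈ _ at hv
  change M.nabla.alg.join (M.nabla.alg.join (v 1) (M.nabla.alg.neg (v 1))) (v 2) ∈ _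
  generalize v 0 = x at hv
  generalize v 1 = y at hv ⊢
  generalize v 2 = z at hv ⊢
  have hA := hM.isReduced.isDeMorgan hL hM.isModel
  rcases x with _ | x | _ <;> rcases y with _ | y | _ <;> rcases z with _ | z | _ <;> first
    | exact absurd hv M.bbot_notMem_nabla
    | exact M.ttop_mem_nabla
    | exact hM.nabla_mem_of_le hL (Adjoin.of z) _
        (congrArg Adjoin.of ((congrArg (M.alg.meet z) (hA.join_comm _ _)).trans
          (hA.meet_join_self _ _))) hv
    | skip
  · exact (M.mem_nabla _).2 (hM.isModel _ _ h M rfl (consVal x fun _ => y)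
      (by rintro _ rfl; exact (M.mem_nabla _).1 hv))
  · exact (M.mem_nabla _).2 (hM.isModel _ _ h' M rfl (consVal x (consVal y fun _ => z))
      (by rintro _ rfl; exact (M.mem_nabla _).1 hv))

theorem DMMatrix.IsProperModel.nabla_em (hM : M.IsProperModel L)
    (h : L ∅ (.join (.var 0) (.neg (.var 0)))) : ISLog {M.nabla} ruleEM.1 ruleEM.2 := by
  rintro _ rfl v -
  change M.nabla.alg.join (v 0) (M.nabla.alg.neg (v 0)) ∈ _
  generalize v 0 = x
  rcases x with _ | x | _
  · exact M.ttop_mem_nabla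
  · exact (M.mem_nabla _).2 (hM.isModel _ _ h M rfl (fun _ => x) (by rintro _ ⟨⟩))
  · exact M.ttop_mem_nabla

end Soundness

/-! ### The finite De Morgan algebras -/

instance : DecidableEq DM4Carrier := fun x y => by
  cases x <;> cases y <;> first | exact isTrue rfl | exact isFalse nofun

instance : Fintype DM4Carrier := ⟨{.zero, .a, .b, .one}, by rintro (_ | _) <;> decide⟩

instance : DecidableEq DM4.carrier := inferInstanceAs (DecidableEq DM4Carrier)

instance : Fintype DM4.carrier := inferInstanceAs (Fintype DM4Carrier)

/-- The element `a` of `DM₄`. -/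
def DM4.a : DM4.carrier := DM4Carrier.a

/-- The element `b` of `DM₄`. -/
def DM4.b : DM4.carrier := DM4Carrier.b

instance : DecidablePred (· ∈ K3Set) := fun x =>
  inferInstanceAs (Decidable (x = .zero ∨ x = .a ∨ x = .one))

instance : DecidablePred (· ∈ B2Set) := fun x =>
  inferInstanceAs (Decidable (x = .zero ∨ x = .one))

instance : DecidableEq K3.carrier := inferInstanceAs (DecidableEq {x // x ∈ K3Set})

instance : Fintype K3.carrier := inferInstanceAs (Fintype {x // x ∈ K3Set})

instance : DecidableEq B2.carrier := inferInstanceAs (DecidableEq {x // x ∈ B2Set})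

instance : Fintype B2.carrier := inferInstanceAs (Fintype {x // x ∈ B2Set})

instance (x y : K3.carrier) : Decidable (x ∈ K3.up y) :=
  inferInstanceAs (Decidable (K3.meet y x = y))

theorem DM4_isDeMorgan : IsDeMorgan DM4 := by
  constructor <;> decide

theorem IsDeMorgan.sub {A : DMAlg.{u}} (h : IsDeMorgan A) {S : Set A.carrier}
    (hS : A.IsClosed S) : IsDeMorgan (A.sub S hS) where
  meet_comm _ _ := Subtype.ext (h.meet_comm _ _)
  join_comm _ _ := Subtype.ext (h.join_comm _ _)
  meet_assoc _ _ _ := Subtype.ext (h.meet_assoc _ _ _)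
  join_assoc _ _ _ := Subtype.ext (h.join_assoc _ _ _)
  meet_join_self _ _ := Subtype.ext (h.meet_join_self _ _)
  join_meet_self _ _ := Subtype.ext (h.join_meet_self _ _)
  meet_join_distrib _ _ _ := Subtype.ext (h.meet_join_distrib _ _ _)
  bot_meet _ := Subtype.ext (h.bot_meet _)
  meet_top _ := Subtype.ext (h.meet_top _)
  neg_join _ _ := Subtype.ext (h.neg_join _ _)
  neg_meet _ _ := Subtype.ext (h.neg_meet _ _)
  neg_neg _ := Subtype.ext (h.neg_neg _)
  neg_top := Subtype.ext h.neg_top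
  neg_bot := Subtype.ext h.neg_bot

theorem K3_isKleene : IsKleene K3 where
  toIsDeMorgan := DM4_isDeMorgan.sub K3Set_closed
  kleene := by decide

theorem B2_isDeMorgan : IsDeMorgan B2 := DM4_isDeMorgan.sub B2Set_closed

/-! ### The De Morgan logics -/

/-- In a De Morgan algebra with `x ∧ ∼x = ⊤`, all elements are equal to `⊤`. -/
theorem IsDeMorgan.eq_top_of_contradiction {A : DMAlg.{u}} (h : IsDeMorgan A) {x : A.carrier}
    (hx : A.meet x (A.neg x) = A.top) (y : A.carrier) : y = A.top := by
  have h₁ : x = A.top := by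
    rw [← h.meet_top x, ← hx, ← h.meet_assoc, h.meet_self]
  have h₂ : A.bot = A.top := by
    rw [← hx, h₁, h.neg_top, h.meet_comm, h.bot_meet]
  rw [← h.meet_top y, ← h₂, h.meet_comm, h.bot_meet]

theorem IsDeMorgan.eq_top_of_meet_eq_top {A : DMAlg.{u}} (h : IsDeMorgan A) {x y : A.carrier}
    (hx : A.meet x y = A.top) : x = A.top ∧ y = A.top := by
  have h₁ : x = A.top := by
    rw [← h.meet_top x, ← hx, ← h.meet_assoc, h.meet_self]
  refine ⟨h₁, ?_⟩
  rw [← hx, h₁, h.meet_comm, h.meet_top]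

theorem IsDeMorgan.bot_join {A : DMAlg.{u}} (h : IsDeMorgan A) (x : A.carrier) :
    A.join A.bot x = x := by
  rw [h.join_comm, ← h.bot_meet x, h.meet_comm, h.join_meet_self]

theorem DMAssertional_isDeMorganLogic {K : Set DMAlg.{u}} (hK : ∀ A ∈ K, IsDeMorgan A) :
    IsDeMorganLogic.{u} (DMAssertional K) where
  meet φ ψ := by
    rintro ⟨A, D⟩ ⟨hA, hD⟩ v hv
    obtain rfl : D = {A.top} := hD
    have h₁ : A.eval v φ = A.top := hv φ (.inl rfl)
    have h₂ : A.eval v ψ = A.top := hv ψ (.inr rfl)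
    change A.meet (A.eval v φ) (A.eval v ψ) = A.top
    rw [h₁, h₂, (hK A hA).meet_self]
  le φ ψ h := by
    rintro ⟨A, D⟩ ⟨hA, hD⟩ v hv
    obtain rfl : D = {A.top} := hD
    have h₁ : A.eval v φ = A.top := hv φ rfl
    have h₂ := h A (hK A hA) v
    rw [h₁] at h₂
    exact ((hK A hA).eq_top_of_meet_eq_top h₂).2

theorem DMAssertional_explosion {K : Set DMAlg.{u}} (hK : ∀ A ∈ K, IsDeMorgan A) :
    DMAssertional K {.meet (.var 0) (.neg (.var 0))} (.var 1) := by
  rintro ⟨A, D⟩ ⟨hA, hD⟩ v hv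
  obtain rfl : D = {A.top} := hD
  exact (hK A hA).eq_top_of_contradiction (hv _ rfl) _

theorem ETL_ds : ETL.{u} {.meet (.var 0) (.join (.neg (.var 0)) (.var 1))} (.var 1) := by
  rintro ⟨A, D⟩ ⟨hA : IsDeMorgan A, hD⟩ v hv
  obtain rfl : D = {A.top} := hD
  obtain ⟨h₁, h₂⟩ := hA.eq_top_of_meet_eq_top (hv _ rfl)
  change v 0 = A.top at h₁
  change A.join (A.neg (v 0)) (v 1) = A.top at h₂
  rw [h₁, hA.neg_top, hA.bot_join] at h₂
  exact h₂

theorem Kone_k1 : Kone.{u} {.join (.meet (.var 0) (.neg (.var 0))) (.var 1)} (.var 1) := by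
  rintro ⟨A, D⟩ ⟨hA : IsKleene A, hD⟩ v hv
  obtain rfl : D = {A.top} := hD
  have h : A.join (A.meet (v 0) (A.neg (v 0))) (v 1) = A.top := hv _ rfl
  change v 1 = A.top
  generalize v 0 = x at h
  generalize v 1 = y at h ⊢
  let := hA.distribLattice
  have le_top : ∀ z : A.carrier, z ≤ A.top := fun z => (hA.le_iff _ _).2 (hA.meet_top z)
  -- `y ∨ ∼y = ⊤`, since `y ∨ ∼y` is above both `x ∧ ∼x` and `y`
  have h₁ : A.top ≤ A.join y (A.neg y) := by
    rw [← h]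
    exact sup_le ((hA.le_iff _ _).2 (hA.kleene x y)) le_sup_left
  have h₂ : A.meet y (A.neg y) = A.bot := by
    have := congrArg A.neg (le_antisymm h₁ (le_top _))
    rw [hA.neg_join, hA.neg_top, hA.neg_neg, hA.meet_comm] at this
    exact this.symm
  -- hence `∼y`, being disjoint from `y`, lies below `x ∧ ∼x`, and dually `x ∧ ∼x ≤ x ∨ ∼x ≤ y`
  have h₃ : A.meet (A.neg y) (A.meet x (A.neg x)) = A.neg y := by
    have := congrArg (A.meet (A.neg y)) h
    rw [hA.meet_join_distrib, hA.meet_top, hA.meet_comm _ y, h₂, hA.join_comm, hA.bot_join] at this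
    exact this
  have h₄ : A.join y (A.join (A.neg x) x) = y := by
    have := congrArg A.neg h₃
    rwa [hA.neg_meet, hA.neg_neg, hA.neg_meet, hA.neg_neg] at this
  have h₅ : A.meet x (A.neg x) ≤ y := by
    rw [← h₄]
    exact le_trans inf_le_left (le_trans (le_sup_right (a := A.neg x)) (le_sup_right (a := y)))
  rw [← h]
  exact (sup_eq_right.2 h₅).symm

theorem DMLog_filter_isDeMorganLogic {A : DMAlg.{u}} (hA : IsDeMorgan A) {D : Set A.carrier}
    (hmeet : ∀ x y, x ∈ D → y ∈ D → A.meet x y ∈ D)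
    (hup : ∀ x y, A.meet x y = x → x ∈ D → y ∈ D) :
    IsDeMorganLogic.{u} (DMLog {⟨A, D⟩}) where
  meet φ ψ := by
    rintro _ rfl v hv
    exact hmeet _ _ (hv φ (.inl rfl)) (hv ψ (.inr rfl))
  le φ ψ h := by
    rintro _ rfl v hv
    exact hup _ _ (h A hA v) (hv φ rfl)

theorem LP_isDeMorganLogic : IsDeMorganLogic.{0} LP :=
  DMLog_filter_isDeMorganLogic K3_isKleene.toIsDeMorgan (by decide) (by decide)

theorem LP_em : LP ∅ (.join (.var 0) (.neg (.var 0))) := by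
  rintro _ rfl v -
  exact (by decide : ∀ x : K3.carrier, K3.join x (K3.neg x) ∈ K3.up K3.a) (v 0)

instance (x : B2.carrier) : Decidable (x ∈ ({B2.top} : Set B2.carrier)) :=
  inferInstanceAs (Decidable (x = B2.top))

theorem CL_isDeMorganLogic : IsDeMorganLogic.{0} CL :=
  DMLog_filter_isDeMorganLogic B2_isDeMorgan (by decide) (by decide)

theorem CL_explosion : CL {.meet (.var 0) (.neg (.var 0))} (.var 1) := by
  rintro _ rfl v hv
  exact absurd (hv _ rfl)
    ((by decide : ∀ x : B2.carrier, B2.meet x (B2.neg x) ∉ ({B2.top} : Set B2.carrier)) (v 0))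

theorem CL_ds : CL {.meet (.var 0) (.join (.neg (.var 0)) (.var 1))} (.var 1) := by
  rintro _ rfl v hv
  exact (by decide : ∀ x y : B2.carrier, B2.meet x (B2.join (B2.neg x) y) ∈
    ({B2.top} : Set B2.carrier) → y ∈ ({B2.top} : Set B2.carrier)) (v 0) (v 1) (hv _ rfl)

theorem CL_em : CL ∅ (.join (.var 0) (.neg (.var 0))) := by
  rintro _ rfl v -
  exact (by decide : ∀ x : B2.carrier, B2.join x (B2.neg x) ∈ ({B2.top} : Set B2.carrier)) (v 0)

theorem Kle_of_le {φ ψ : DMFm} (h : ∀ A : DMAlg.{u}, IsKleene A → ∀ v : ℕ → A.carrier,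
    A.meet (A.eval v φ) (A.eval v ψ) = A.eval v φ) : Kle.{u} {φ} ψ :=
  .inr ⟨φ, [], rfl, by simp, h⟩

theorem Kle_isDeMorganLogic : IsDeMorganLogic.{u} Kle.{u} where
  meet φ ψ := .inr ⟨φ, [ψ], .inl rfl, by simp, fun _ hA _ => IsDeMorgan.meet_self hA.1 _⟩
  le _ _ h := Kle_of_le fun A hA => h A hA.toIsDeMorgan

theorem Kle_kleene :
    Kle.{u} {.meet (.var 0) (.neg (.var 0))} (.join (.var 1) (.neg (.var 1))) :=
  Kle_of_le fun _ hA v => hA.kleene (v 0) (v 1)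

theorem Kle_rule : Kle.{u} {.join (.meet (.var 0) (.neg (.var 0))) (.var 2)}
    (.join (.join (.var 1) (.neg (.var 1))) (.var 2)) :=
  Kle_of_le fun A hA v => by
    let := hA.distribLattice
    exact (hA.le_iff _ _).1
      (sup_le_sup_right ((hA.le_iff _ _).2 (hA.kleene (v 0) (v 1))) (v 2))

/-! ### Finite reduced models, in every universe -/

/-- The copy of an algebra in a universe `u`. -/
def DMAlg.ulift (A : DMAlg.{0}) : DMAlg.{u} where
  carrier := ULift.{u} A.carrier
  meet x y := ⟨A.meet x.down y.down⟩
  join x y := ⟨A.join x.down y.down⟩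
  neg x := ⟨A.neg x.down⟩
  bot := ⟨A.bot⟩
  top := ⟨A.top⟩

/-- The copy of a matrix in a universe `u`. -/
def DMMatrix.ulift (M : DMMatrix.{0}) : DMMatrix.{u} := ⟨M.alg.ulift, ULift.down ⁻¹' M.D⟩

theorem IsDeMorgan.ulift {A : DMAlg.{0}} (h : IsDeMorgan A) : IsDeMorgan (DMAlg.ulift.{u} A) where
  meet_comm _ _ := congrArg ULift.up (h.meet_comm _ _)
  join_comm _ _ := congrArg ULift.up (h.join_comm _ _)
  meet_assoc _ _ _ := congrArg ULift.up (h.meet_assoc _ _ _)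
  join_assoc _ _ _ := congrArg ULift.up (h.join_assoc _ _ _)
  meet_join_self _ _ := congrArg ULift.up (h.meet_join_self _ _)
  join_meet_self _ _ := congrArg ULift.up (h.join_meet_self _ _)
  meet_join_distrib _ _ _ := congrArg ULift.up (h.meet_join_distrib _ _ _)
  bot_meet _ := congrArg ULift.up (h.bot_meet _)
  meet_top _ := congrArg ULift.up (h.meet_top _)
  neg_join _ _ := congrArg ULift.up (h.neg_join _ _)
  neg_meet _ _ := congrArg ULift.up (h.neg_meet _ _)
  neg_neg _ := congrArg ULift.up (h.neg_neg _)
  neg_top := congrArg ULift.up h.neg_top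
  neg_bot := congrArg ULift.up h.neg_bot

theorem IsKleene.ulift {A : DMAlg.{0}} (h : IsKleene A) : IsKleene (DMAlg.ulift.{u} A) where
  toIsDeMorgan := h.toIsDeMorgan.ulift
  kleene _ _ := congrArg ULift.up (h.kleene _ _)

theorem DMAlg.ulift_eval (A : DMAlg.{0}) (v : ℕ → ULift.{u} A.carrier) (φ : DMFm) :
    ((DMAlg.ulift.{u} A).eval v φ).down = A.eval (fun n => (v n).down) φ := by
  induction φ with
  | var n => rfl
  | meet φ ψ h₁ h₂ => exact congrArg₂ A.meet h₁ h₂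
  | join φ ψ h₁ h₂ => exact congrArg₂ A.join h₁ h₂
  | neg φ h => exact congrArg A.neg h
  | bot => rfl
  | top => rfl

theorem DMMatrix.ulift_isModel (M : DMMatrix.{0}) : (DMMatrix.ulift.{u} M).IsModel (DMLog {M}) := by
  rintro Γ φ h _ rfl v hv
  have e := fun ψ => M.alg.ulift_eval v ψ
  change ((DMAlg.ulift.{u} M.alg).eval v φ).down ∈ M.D
  rw [e]
  refine h M rfl _ fun γ hγ => ?_
  rw [← e]
  exact hv γ hγ

theorem DMMatrix.IsReduced.ulift {M : DMMatrix.{0}} (h : M.IsReduced) :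
    (DMMatrix.ulift.{u} M).IsReduced := by
  intro θ hθ hD x y hxy
  have := h (θ.comap ULift.up)
    ⟨fun _ _ _ _ h₁ h₂ => hθ.meet _ _ _ _ h₁ h₂, fun _ _ _ _ h₁ h₂ => hθ.join _ _ _ _ h₁ h₂,
      fun _ _ h₁ => hθ.neg _ _ h₁⟩ (fun x y hxy hx => hD _ _ hxy hx) x.down y.down hxy
  exact congrArg ULift.up this

theorem DMMatrix.ulift_ne_univ {M : DMMatrix.{0}} (h : M.D ≠ Set.univ) :
    (DMMatrix.ulift.{u} M).D ≠ Set.univ := fun h' =>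
  h (Set.eq_univ_of_forall fun x => (h' ▸ Set.mem_univ (ULift.up x) : _ ∈ (ulift M).D))

/-- The matrix `⟨DM₄, {1}⟩`. -/
def matDM4 : DMMatrix.{0} := ⟨DM4, {DM4.top}⟩

/-- The matrix `⟨K₃, ↑a⟩`. -/
def matK3a : DMMatrix.{0} := ⟨K3, K3.up K3.a⟩

/-- The matrix `⟨K₃, {1}⟩`. -/
def matK3one : DMMatrix.{0} := ⟨K3, {K3.top}⟩

/-- The matrix `⟨B₂, {1}⟩`. -/
def matB2 : DMMatrix.{0} := ⟨B2, {B2.top}⟩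

/-- A matrix is reduced if its elements `x` are separated by the membership of `x`, `∼x` and `x ∨ c`
in the set of designated elements. -/
theorem DMMatrix.isReduced_of_separating {M : DMMatrix.{u}} (c : M.alg.carrier)
    (h : ∀ x y, (x ∈ M.D ↔ y ∈ M.D) → (M.alg.neg x ∈ M.D ↔ M.alg.neg y ∈ M.D) →
      (M.alg.join x c ∈ M.D ↔ M.alg.join y c ∈ M.D) → x = y) : M.IsReduced := by
  intro θ hθ hD x y hxy
  have key : ∀ x y, θ x y → (x ∈ M.D ↔ y ∈ M.D) :=
    fun x y hxy => ⟨hD x y hxy, hD y x (θ.symm hxy)⟩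
  exact h x y (key _ _ hxy) (key _ _ (hθ.neg _ _ hxy))
    (key _ _ (hθ.join _ _ _ _ hxy (θ.refl c)))

instance (x : DM4.carrier) : Decidable (x ∈ matDM4.D) := inferInstanceAs (Decidable (x = DM4.top))

instance (x : K3.carrier) : Decidable (x ∈ matK3a.D) := inferInstanceAs (Decidable (x ∈ K3.up K3.a))

instance (x : K3.carrier) : Decidable (x ∈ ({K3.top} : Set K3.carrier)) :=
  inferInstanceAs (Decidable (x = K3.top))

instance (x : K3.carrier) : Decidable (x ∈ matK3one.D) := inferInstanceAs (Decidable (x = K3.top))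

instance (x : B2.carrier) : Decidable (x ∈ matB2.D) := inferInstanceAs (Decidable (x = B2.top))

theorem matDM4_isReduced : matDM4.IsReduced :=
  DMMatrix.isReduced_of_separating (M := matDM4) DM4.a (by
    change ∀ x y : DM4.carrier, (x ∈ matDM4.D ↔ y ∈ matDM4.D) →
      (DM4.neg x ∈ matDM4.D ↔ DM4.neg y ∈ matDM4.D) →
      (DM4.join x DM4.a ∈ matDM4.D ↔ DM4.join y DM4.a ∈ matDM4.D) → x = y
    decide)

theorem matK3a_isReduced : matK3a.IsReduced :=
  DMMatrix.isReduced_of_separating (M := matK3a) K3.a fun x y h₁ h₂ _ =>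
    (by decide : ∀ x y : K3.carrier, (x ∈ matK3a.D ↔ y ∈ matK3a.D) →
      (K3.neg x ∈ matK3a.D ↔ K3.neg y ∈ matK3a.D) → x = y) x y h₁ h₂

theorem matK3one_isReduced : matK3one.IsReduced :=
  DMMatrix.isReduced_of_separating (M := matK3one) K3.a fun x y h₁ h₂ _ =>
    (by decide : ∀ x y : K3.carrier, (x ∈ matK3one.D ↔ y ∈ matK3one.D) →
      (K3.neg x ∈ matK3one.D ↔ K3.neg y ∈ matK3one.D) → x = y) x y h₁ h₂

theorem matB2_isReduced : matB2.IsReduced :=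
  DMMatrix.isReduced_of_separating (M := matB2) B2.top fun x y h₁ _ _ =>
    (by decide : ∀ x y : B2.carrier, (x ∈ matB2.D ↔ y ∈ matB2.D) → x = y) x y h₁

theorem ne_univ_of_notMem {α : Type u} {D : Set α} {x : α} (h : x ∉ D) : D ≠ Set.univ :=
  fun e => h (e ▸ Set.mem_univ x)

theorem DMAssertional_isModel {K : Set DMAlg.{u}} {A : DMAlg.{0}} (hA : A.ulift ∈ K) :
    (DMMatrix.ulift.{u} ⟨A, {A.top}⟩).IsModel (DMAssertional K) := by
  rintro Γ φ h _ rfl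
  refine h _ ⟨hA, ?_⟩
  ext x
  exact ULift.down_inj (b := ULift.up A.top)

theorem Kle_isModel {D : Set K3.carrier} (htop : K3.top ∈ D)
    (hmeet : ∀ x y, x ∈ D → y ∈ D → K3.meet x y ∈ D)
    (hup : ∀ x y, K3.meet x y = x → x ∈ D → y ∈ D) :
    (DMMatrix.ulift.{u} ⟨K3, D⟩).IsModel Kle.{u} := by
  rintro Γ φ h _ rfl v hv
  rcases h with ⟨-, h⟩ | ⟨γ, l, hγ, hl, h⟩
  · change ((DMAlg.ulift.{u} K3).eval v φ).down ∈ D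
    have e : (DMAlg.ulift.{u} K3).eval v φ = ⟨K3.top⟩ := h _ K3_isKleene.ulift v
    rw [e]
    exact htop
  · refine hup _ _ (congrArg ULift.down (h _ K3_isKleene.ulift v)) ?_
    have key : ∀ (l : List DMFm) (γ : DMFm), ((DMAlg.ulift.{u} K3).eval v γ).down ∈ D →
        (∀ ψ ∈ l, ψ ∈ Γ) → ((DMAlg.ulift.{u} K3).eval v (l.foldl .meet γ)).down ∈ D := by
      intro l
      induction l with
      | nil => exact fun γ hγ _ => hγ
      | cons ψ l ih =>
        intro γ hγ hl
        exact ih (.meet γ ψ)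
          (hmeet _ _ hγ (hv ψ (hl ψ (by simp)))) fun χ hχ => hl χ (by simp [hχ])
    exact key l γ (hv γ hγ) hl

theorem matDM4_isProperModel : (DMMatrix.ulift.{u} matDM4).IsProperModel ETL.{u} :=
  ⟨DMAssertional_isModel DM4_isDeMorgan.ulift, matDM4_isReduced.ulift,
    DMMatrix.ulift_ne_univ (ne_univ_of_notMem (by decide : DM4.bot ∉ matDM4.D))⟩

theorem matK3a_ne_univ : matK3a.D ≠ Set.univ :=
  ne_univ_of_notMem (by decide : K3.bot ∉ matK3a.D)

theorem matK3one_ne_univ : matK3one.D ≠ Set.univ :=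
  ne_univ_of_notMem (by decide : K3.bot ∉ matK3one.D)

theorem matK3a_isProperModel_LP : (DMMatrix.ulift.{u} matK3a).IsProperModel LP :=
  ⟨matK3a.ulift_isModel, matK3a_isReduced.ulift, DMMatrix.ulift_ne_univ matK3a_ne_univ⟩

theorem matK3one_isProperModel_Kone : (DMMatrix.ulift.{u} matK3one).IsProperModel Kone.{u} :=
  ⟨DMAssertional_isModel K3_isKleene.ulift, matK3one_isReduced.ulift,
    DMMatrix.ulift_ne_univ matK3one_ne_univ⟩

theorem matK3a_isProperModel_Kle : (DMMatrix.ulift.{u} matK3a).IsProperModel Kle.{u} :=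
  ⟨Kle_isModel (by decide) (by decide) (by decide), matK3a_isReduced.ulift,
    DMMatrix.ulift_ne_univ matK3a_ne_univ⟩

theorem matK3one_isProperModel_Kle : (DMMatrix.ulift.{u} matK3one).IsProperModel Kle.{u} :=
  ⟨Kle_isModel (D := {K3.top}) (by decide) (by decide) (by decide), matK3one_isReduced.ulift,
    DMMatrix.ulift_ne_univ matK3one_ne_univ⟩

theorem matB2_isProperModel : (DMMatrix.ulift.{u} matB2).IsProperModel CL :=
  ⟨matB2.ulift_isModel, matB2_isReduced.ulift,
    DMMatrix.ulift_ne_univ (ne_univ_of_notMem (by decide : B2.bot ∉ matB2.D))⟩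

/-! ### Embeddings of the finite matrices over involutive Stone algebras -/

/-- The isomorphism of `IS₆` with `DM₄^∇`. -/
def toNablaDM4 : IS6.carrier → (DMAlg.ulift.{u} DM4).nabla.carrier
  | .bbot => .bbot
  | .zero => .of ⟨.zero⟩
  | .a => .of ⟨.a⟩
  | .b => .of ⟨.b⟩
  | .one => .of ⟨.one⟩
  | .ttop => .ttop

theorem toNablaDM4_isHom :
    ISAlg.IsHom (A := IS6) (B := (DMAlg.ulift.{u} DM4).nabla) toNablaDM4.{u} where
  meet := by rintro (_ | _) (_ | _) <;> rfl
  join := by rintro (_ | _) (_ | _) <;> rfl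
  neg := by rintro (_ | _) <;> rfl
  nab := by rintro (_ | _) <;> rfl
  bot := rfl
  top := rfl

instance : DecidableEq IS5.carrier := inferInstanceAs (DecidableEq {x : IS6Carrier // x ∈ IS5Set})

instance : DecidableEq IS4.carrier := inferInstanceAs (DecidableEq {x : IS6Carrier // x ∈ IS4Set})

instance (x y : IS5.carrier) : Decidable (x ∈ IS5.up y) :=
  inferInstanceAs (Decidable (IS5.meet y x = y))

instance (x y : IS4.carrier) : Decidable (x ∈ IS4.up y) :=
  inferInstanceAs (Decidable (IS4.meet y x = y))

/-- The isomorphism of `IS₅` with `K₃^∇`. -/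
def toNablaK3 : IS5.carrier → (DMAlg.ulift.{u} K3).nabla.carrier
  | ⟨.bbot, _⟩ => .bbot
  | ⟨.zero, _⟩ => .of ⟨K3.bot⟩
  | ⟨.a, _⟩ => .of ⟨K3.a⟩
  | ⟨.b, h⟩ => absurd h (by decide : IS6.b ∉ IS5Set)
  | ⟨.one, _⟩ => .of ⟨K3.top⟩
  | ⟨.ttop, _⟩ => .ttop

theorem toNablaK3_isHom :
    ISAlg.IsHom (A := IS5) (B := (DMAlg.ulift.{u} K3).nabla) toNablaK3.{u} where
  meet := by rintro ⟨_, rfl | rfl | rfl | rfl | rfl⟩ ⟨_, rfl | rfl | rfl | rfl | rfl⟩ <;> rfl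
  join := by rintro ⟨_, rfl | rfl | rfl | rfl | rfl⟩ ⟨_, rfl | rfl | rfl | rfl | rfl⟩ <;> rfl
  neg := by rintro ⟨_, rfl | rfl | rfl | rfl | rfl⟩ <;> rfl
  nab := by rintro ⟨_, rfl | rfl | rfl | rfl | rfl⟩ <;> rfl
  bot := rfl
  top := rfl

/-- The isomorphism of `IS₄` with `B₂^∇`. -/
def toNablaB2 : IS4.carrier → (DMAlg.ulift.{u} B2).nabla.carrier
  | ⟨.bbot, _⟩ => .bbot
  | ⟨.zero, _⟩ => .of ⟨B2.bot⟩
  | ⟨.a, h⟩ => absurd h (by decide : IS6.a ∉ IS4Set)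
  | ⟨.b, h⟩ => absurd h (by decide : IS6.b ∉ IS4Set)
  | ⟨.one, _⟩ => .of ⟨B2.top⟩
  | ⟨.ttop, _⟩ => .ttop

theorem toNablaB2_isHom :
    ISAlg.IsHom (A := IS4) (B := (DMAlg.ulift.{u} B2).nabla) toNablaB2.{u} where
  meet := by rintro ⟨_, rfl | rfl | rfl | rfl⟩ ⟨_, rfl | rfl | rfl | rfl⟩ <;> rfl
  join := by rintro ⟨_, rfl | rfl | rfl | rfl⟩ ⟨_, rfl | rfl | rfl | rfl⟩ <;> rfl
  neg := by rintro ⟨_, rfl | rfl | rfl | rfl⟩ <;> rfl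
  nab := by rintro ⟨_, rfl | rfl | rfl | rfl⟩ <;> rfl
  bot := rfl
  top := rfl

theorem nablaLogic_apply {L : DMRel} {M : DMMatrix.{u}} (hM : M.IsProperModel L) {Γ : Set ISFm}
    {φ : ISFm} (h : nablaLogic.{u} L Γ φ) : ISLog {M.nabla} Γ φ := by
  rintro _ rfl
  exact h _ ⟨M, hM.isModel, hM.isReduced, hM.ne_univ, rfl⟩

theorem ISLog_IS6one_of_nablaLogic {Γ : Set ISFm} {φ : ISFm} (h : nablaLogic.{u} ETL.{u} Γ φ) :
    ISLog {matIS6one} Γ φ := by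
  refine ISLog_of_strict_hom (M := matIS6one) toNablaDM4_isHom.{u} ?_
    (nablaLogic_apply matDM4_isProperModel h)
  have ht := (DMMatrix.ulift.{u} matDM4).ttop_mem_nabla
  have hb := (DMMatrix.ulift.{u} matDM4).bbot_notMem_nabla
  have hm := fun x => (DMMatrix.ulift.{u} matDM4).mem_nabla ⟨x⟩
  rintro (_ | _)
  · exact iff_of_false hb (by decide : IS6.bot ∉ IS6.up IS6.one)
  · exact (hm _).trans (iff_of_false (by decide : DM4.bot ∉ matDM4.D)
      (by decide : IS6.neg IS6.one ∉ IS6.up IS6.one))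
  · exact (hm _).trans (iff_of_false (by decide : DM4.a ∉ matDM4.D)
      (by decide : IS6.a ∉ IS6.up IS6.one))
  · exact (hm _).trans (iff_of_false (by decide : DM4.b ∉ matDM4.D)
      (by decide : IS6.b ∉ IS6.up IS6.one))
  · exact (hm _).trans (iff_of_true (by decide : DM4.top ∈ matDM4.D)
      (by decide : IS6.one ∈ IS6.up IS6.one))
  · exact iff_of_true ht (by decide : IS6.top ∈ IS6.up IS6.one)

theorem ISLog_IS5a_of_isProperModel {L : DMRel}
    (hM : (DMMatrix.ulift.{u} matK3a).IsProperModel L) {Γ : Set ISFm} {φ : ISFm}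
    (h : nablaLogic.{u} L Γ φ) : ISLog {matIS5a} Γ φ := by
  refine ISLog_of_strict_hom (M := matIS5a) toNablaK3_isHom.{u} ?_ (nablaLogic_apply hM h)
  have ht := (DMMatrix.ulift.{u} matK3a).ttop_mem_nabla
  have hb := (DMMatrix.ulift.{u} matK3a).bbot_notMem_nabla
  have hm := fun x => (DMMatrix.ulift.{u} matK3a).mem_nabla ⟨x⟩
  rintro ⟨_, rfl | rfl | rfl | rfl | rfl⟩
  · exact iff_of_false hb (by decide : IS5.bot ∉ IS5.up IS5.a)
  · exact (hm _).trans (iff_of_false (by decide : K3.bot ∉ matK3a.D)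
      (by decide : IS5.neg IS5.one ∉ IS5.up IS5.a))
  · exact (hm _).trans (iff_of_true (by decide : K3.a ∈ matK3a.D)
      (by decide : IS5.a ∈ IS5.up IS5.a))
  · exact (hm _).trans (iff_of_true (by decide : K3.top ∈ matK3a.D)
      (by decide : IS5.one ∈ IS5.up IS5.a))
  · exact iff_of_true ht (by decide : IS5.top ∈ IS5.up IS5.a)

theorem ISLog_IS5one_of_isProperModel {L : DMRel}
    (hM : (DMMatrix.ulift.{u} matK3one).IsProperModel L) {Γ : Set ISFm} {φ : ISFm}
    (h : nablaLogic.{u} L Γ φ) : ISLog {matIS5one} Γ φ := by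
  refine ISLog_of_strict_hom (M := matIS5one) toNablaK3_isHom.{u} ?_ (nablaLogic_apply hM h)
  have ht := (DMMatrix.ulift.{u} matK3one).ttop_mem_nabla
  have hb := (DMMatrix.ulift.{u} matK3one).bbot_notMem_nabla
  have hm := fun x => (DMMatrix.ulift.{u} matK3one).mem_nabla ⟨x⟩
  rintro ⟨_, rfl | rfl | rfl | rfl | rfl⟩
  · exact iff_of_false hb (by decide : IS5.bot ∉ IS5.up IS5.one)
  · exact (hm _).trans (iff_of_false (by decide : K3.bot ∉ matK3one.D)
      (by decide : IS5.neg IS5.one ∉ IS5.up IS5.one))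
  · exact (hm _).trans (iff_of_false (by decide : K3.a ∉ matK3one.D)
      (by decide : IS5.a ∉ IS5.up IS5.one))
  · exact (hm _).trans (iff_of_true (by decide : K3.top ∈ matK3one.D)
      (by decide : IS5.one ∈ IS5.up IS5.one))
  · exact iff_of_true ht (by decide : IS5.top ∈ IS5.up IS5.one)

theorem ISLog_IS4one_of_nablaLogic {Γ : Set ISFm} {φ : ISFm} (h : nablaLogic.{u} CL Γ φ) :
    ISLog {matIS4one} Γ φ := by
  refine ISLog_of_strict_hom (M := matIS4one) toNablaB2_isHom.{u} ?_
    (nablaLogic_apply matB2_isProperModel h)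
  have ht := (DMMatrix.ulift.{u} matB2).ttop_mem_nabla
  have hb := (DMMatrix.ulift.{u} matB2).bbot_notMem_nabla
  have hm := fun x => (DMMatrix.ulift.{u} matB2).mem_nabla ⟨x⟩
  rintro ⟨_, rfl | rfl | rfl | rfl⟩
  · exact iff_of_false hb (by decide : IS4.bot ∉ IS4.up IS4.one)
  · exact (hm _).trans (iff_of_false (by decide : B2.bot ∉ matB2.D)
      (by decide : IS4.neg IS4.one ∉ IS4.up IS4.one))
  · exact (hm _).trans (iff_of_true (by decide : B2.top ∈ matB2.D)
      (by decide : IS4.one ∈ IS4.up IS4.one))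
  · exact iff_of_true ht (by decide : IS4.top ∈ IS4.up IS4.one)

/-! ### The five equalities -/

theorem ISRel.eq_and_eq_of_cycle {L₁ L₂ L₃ : ISRel} (h₂₁ : ∀ {Γ φ}, L₂ Γ φ → L₁ Γ φ)
    (h₁₃ : ∀ {Γ φ}, L₁ Γ φ → L₃ Γ φ) (h₃₂ : ∀ {Γ φ}, L₃ Γ φ → L₂ Γ φ) : L₁ = L₂ ∧ L₂ = L₃ := by
  constructor <;> funext Γ φ <;> apply propext
  · exact ⟨fun h => h₃₂ (h₁₃ h), h₂₁⟩
  · exact ⟨fun h => h₁₃ (h₂₁ h), h₃₂⟩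

theorem nablaLogic_ETL : ISLog {matIS6one} = nablaLogic.{u} ETL.{u} ∧
    nablaLogic.{u} ETL.{u} = extend ISle.{u} {ruleDS} := by
  refine ISRel.eq_and_eq_of_cycle ISLog_IS6one_of_nablaLogic extend_of_ISLog_IS6one
    (nablaLogic_of_extend (DMAssertional_isDeMorganLogic fun _ h => h) ?_)
  rintro M hM _ rfl
  exact hM.nabla_ds (DMAssertional_explosion fun _ h => h) ETL_ds

theorem nablaLogic_LP : ISLog {matIS5a} = nablaLogic.{u} LP ∧
    nablaLogic.{u} LP = extend ISle.{u} {ruleEM} := by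
  refine ISRel.eq_and_eq_of_cycle (ISLog_IS5a_of_isProperModel matK3a_isProperModel_LP)
    extend_of_ISLog_IS5a (nablaLogic_of_extend LP_isDeMorganLogic ?_)
  rintro M hM _ rfl
  exact hM.nabla_em LP_em

theorem nablaLogic_Kone : ISLog {matIS5one} = nablaLogic.{u} Kone.{u} ∧
    nablaLogic.{u} Kone.{u} = extend ISle.{u} {ruleK1} := by
  refine ISRel.eq_and_eq_of_cycle (ISLog_IS5one_of_isProperModel matK3one_isProperModel_Kone)
    extend_of_ISLog_IS5one
    (nablaLogic_of_extend (DMAssertional_isDeMorganLogic fun _ h => IsKleene.toIsDeMorgan h) ?_)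
  rintro M hM _ rfl
  exact hM.nabla_k1 (DMAssertional_explosion fun _ h => IsKleene.toIsDeMorgan h) Kone_k1

theorem nablaLogic_Kle : ISLog {matIS5a, matIS5one} = nablaLogic.{u} Kle.{u} ∧
    nablaLogic.{u} Kle.{u} = extend ISle.{u} {ruleKle} := by
  refine ISRel.eq_and_eq_of_cycle (fun h => ?_) extend_of_ISLog_IS5
    (nablaLogic_of_extend Kle_isDeMorganLogic ?_)
  · rintro _ (rfl | rfl)
    · exact ISLog_IS5a_of_isProperModel matK3a_isProperModel_Kle h _ rfl
    · exact ISLog_IS5one_of_isProperModel matK3one_isProperModel_Kle h _ rfl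
  · rintro M hM _ rfl
    exact hM.nabla_kle Kle_isDeMorganLogic Kle_kleene Kle_rule

theorem nablaLogic_CL : ISLog {matIS4one} = nablaLogic.{u} CL ∧
    nablaLogic.{u} CL = extend ISle.{u} {ruleDS, ruleEM} := by
  refine ISRel.eq_and_eq_of_cycle ISLog_IS4one_of_nablaLogic extend_of_ISLog_IS4one
    (nablaLogic_of_extend CL_isDeMorganLogic ?_)
  rintro M hM _ (rfl | rfl)
  · exact hM.nabla_ds CL_explosion CL_ds
  · exact hM.nabla_em CL_em

end ISLogic

theorem mainTheorem10 :
    (ISLogic.ISLog {ISLogic.matIS6one} = ISLogic.nablaLogic.{u} ISLogic.ETL.{u} ∧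
      ISLogic.nablaLogic.{u} ISLogic.ETL.{u} =
        ISLogic.extend ISLogic.ISle.{u} {ISLogic.ruleDS}) ∧
    (ISLogic.ISLog {ISLogic.matIS5a} = ISLogic.nablaLogic.{u} ISLogic.LP ∧
      ISLogic.nablaLogic.{u} ISLogic.LP =
        ISLogic.extend ISLogic.ISle.{u} {ISLogic.ruleEM}) ∧
    (ISLogic.ISLog {ISLogic.matIS5one} = ISLogic.nablaLogic.{u} ISLogic.Kone.{u} ∧
      ISLogic.nablaLogic.{u} ISLogic.Kone.{u} =
        ISLogic.extend ISLogic.ISle.{u} {ISLogic.ruleK1}) ∧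
    (ISLogic.ISLog {ISLogic.matIS5a, ISLogic.matIS5one} =
        ISLogic.nablaLogic.{u} ISLogic.Kle.{u} ∧
      ISLogic.nablaLogic.{u} ISLogic.Kle.{u} =
        ISLogic.extend ISLogic.ISle.{u} {ISLogic.ruleKle}) ∧
    (ISLogic.ISLog {ISLogic.matIS4one} = ISLogic.nablaLogic.{u} ISLogic.CL ∧
      ISLogic.nablaLogic.{u} ISLogic.CL =
        ISLogic.extend ISLogic.ISle.{u} {ISLogic.ruleDS, ISLogic.ruleEM}) := by
  exact ⟨ISLogic.nablaLogic_ETL, ISLogic.nablaLogic_LP, ISLogic.nablaLogic_Kone,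
    ISLogic.nablaLogic_Kle, ISLogic.nablaLogic_CL⟩
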